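/- Let $\mathbf{F}$ be an algebraic closure of $\mathbf{F}_2$, and consider the tower $\cdots\to C_2\to C_1\to C_0=\mathbf{P}^1$ of smooth projective curves over $\mathbf{F}$, where $C_n$ has function field $\mathbf{F}(x_0,x_1,\ldots,x_n)$ with $x_0$ transcendental over $\mathbf{F}$ and $$x_{k+1}^2+x_{k+1}=x_k+1+\frac1{x_k}\qquad (k\ge 0).$$ For $a_0,\ldots,a_n\in\mathbf{P}^1(\mathbf{F})=\mathbf{F}\cup\{\infty\}$, write $P(a_0,\ldots,a_n)$ for any point $P$ of $C_n$ with $x_k(P)=a_k$ for $0\le k\le n$ (there may be several such points). Let $\rho\in\mathbf{F}$ be a primitive third root of unity, i.e. a generator of $\mathbf{F}_4^*$, and write $\infty^j$ for $j$ consecutive entries $\infty$. **Theorem.** Let $i,j\ge 0$, and let $P_{i+j}=P(a_0,\ldots,a_{i-1},0,\infty^j)$ be a point of $C_{i+j}$ with $a_0\in\{\rho,\rho^2\}$. (Then $i$ is odd, and $P_{i+j}$ is a pole of $x_{i+j}$ if $j\ge1$, and a pole of $1/x_i$ if $j=0$.) Then 1. if $j\in\{0,2,4,\ldots,i-3\}$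 or $j\ge i-1$, the point $P_{i+j}$ is totally ramified in $C_{i+j+1}/C_{i+j}$, and its contribution to the ramification divisor of $C_{i+j+1}/C_{i+j}$ is $2$; 2. if $j\in\{1,3,5,\ldots,i-2\}$, the point $P_{i+j}$ is unramified in $C_{i+j+1}/C_{i+j}$. -/

import Mathlib

open scoped OnePoint

noncomputable section

namespace ASTower

/-- Over an algebraically closed field the Artin-Schreier equation `y² + y = c` is solvable. -/
theorem exists_artinSchreier_root {L : Type*} [Field L] [IsAlgClosed L] (c : L) :
    ∃ y : L, y ^ 2 + y = c := by
  have hd : (Polynomial.X ^ 2 + (Polynomial.X - Polynomial.C c) : Polynomial L).degree = 2 := by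
    rw [Polynomial.degree_add_eq_left_of_degree_lt]
    · simp
    · rw [Polynomial.degree_X_pow, Polynomial.degree_X_sub_C]; norm_num
  obtain ⟨y, hy⟩ := IsAlgClosed.exists_root
    (Polynomial.X ^ 2 + (Polynomial.X - Polynomial.C c) : Polynomial L) (by rw [hd]; norm_num)
  refine ⟨y, ?_⟩
  simp only [Polynomial.IsRoot, Polynomial.eval_add, Polynomial.eval_pow, Polynomial.eval_X,
    Polynomial.eval_sub, Polynomial.eval_C] at hy
  linear_combination hy

/-- An ambient field for the function fields of all curves of the tower over `F`. -/
abbrev Ambient (F : Type*) [Field F] : Type _ := AlgebraicClosure (RatFunc F)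

/-- The coordinate functions of the tower: `x₀` is the variable of `F(x₀)`, and `x_{k+1}` is a root
of `y² + y = x_k + 1 + 1/x_k`. -/
def x (F : Type*) [Field F] : ℕ → Ambient F
  | 0 => algebraMap (RatFunc F) (Ambient F) RatFunc.X
  | k + 1 => (exists_artinSchreier_root (x F k + 1 + (x F k)⁻¹)).choose

theorem x_zero (F : Type*) [Field F] :
    x F 0 = algebraMap (RatFunc F) (Ambient F) RatFunc.X := rfl

theorem x_succ (F : Type*) [Field F] (k : ℕ) :
    x F (k + 1) ^ 2 + x F (k + 1) = x F k + 1 + (x F k)⁻¹ :=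
  (exists_artinSchreier_root (x F k + 1 + (x F k)⁻¹)).choose_spec

/-- The function field `F(x₀, …, x_n)` of the curve `C_n` over `F`. -/
def functionField (F : Type*) [Field F] (n : ℕ) : IntermediateField F (Ambient F) :=
  IntermediateField.adjoin F (x F '' Set.Iic n)

theorem x_mem_functionField (F : Type*) [Field F] {k n : ℕ} (h : k ≤ n) :
    x F k ∈ functionField F n :=
  IntermediateField.subset_adjoin F _ ⟨k, h, rfl⟩

theorem functionField_le_succ (F : Type*) [Field F] (n : ℕ) :
    functionField F n ≤ functionField F (n + 1) :=
  IntermediateField.adjoin.mono F _ _ (Set.image_mono (Set.Iic_subset_Iic.2 n.le_succ))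

/-- The coordinate function `x_k` on `C_n`, for `k ≤ n`. -/
def coord (F : Type*) [Field F] (n k : ℕ) (h : k ≤ n) : functionField F n :=
  ⟨x F k, x_mem_functionField F h⟩

/-- The pull-back of functions along the cover `C_{n+1} → C_n`. -/
def pullback (F : Type*) [Field F] (n : ℕ) : functionField F n →ₐ[F] functionField F (n + 1) :=
  IntermediateField.inclusion (functionField_le_succ F n)

instance (F : Type*) [Field F] (n : ℕ) : Algebra (functionField F n) (functionField F (n + 1)) :=
  (pullback F n).toRingHom.toAlgebra

/-- A point of the smooth projective curve `C_n` over the algebraically closed field `F`, given by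
its local ring: a nontrivial valuation ring of the function field of `C_n` that contains the
constants. -/
@[ext]
structure Point (F : Type*) [Field F] (n : ℕ) where
  /-- The local ring of the point. -/
  localRing : ValuationSubring (functionField F n)
  algebraMap_mem : ∀ c : F, algebraMap F (functionField F n) c ∈ localRing
  ne_top : localRing ≠ ⊤

namespace Point

/-- `f(P) = a`, where `a` is a point of `ℙ¹(F) = F ∪ {∞}`: for `a = c` in `F` this says that `f - c`
is in the maximal ideal of the local ring of `P`, and for `a = ∞` that `f` has a pole in `P`. -/
def HasValue {F : Type*} [Field F] {n : ℕ} (P : Point F n) (f : functionField F n)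
    (a : OnePoint F) : Prop :=
  a.elim (f ∉ P.localRing)
    (fun c => P.localRing.valuation (f - algebraMap F (functionField F n) c) < 1)

/-- `P` is a point `P(a₀, …, a_n)`, that is, `x_k(P) = a_k` for `0 ≤ k ≤ n`. The terms `a_k` with
`k > n` play no role. -/
def HasIndexSequence {F : Type*} [Field F] {n : ℕ} (P : Point F n) (a : ℕ → OnePoint F) : Prop :=
  ∀ (k : ℕ) (h : k ≤ n), P.HasValue (coord F n k h) (a k)

/-- `P` is the image of `Q` under the cover `C_{n+1} → C_n`. -/
def LiesOver {F : Type*} [Field F] {n : ℕ} (Q : Point F (n + 1)) (P : Point F n) : Prop :=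
  Q.localRing.comap (pullback F n).toRingHom = P.localRing

/-- The homomorphism of local rings `O_P → O_Q` for a point `Q` over `P`. -/
def localHom {F : Type*} [Field F] {n : ℕ} {Q : Point F (n + 1)} {P : Point F n}
    (h : Q.LiesOver P) : P.localRing →+* Q.localRing :=
  (pullback F n).toRingHom.restrict P.localRing Q.localRing (fun f hf => by
    have hf' : f ∈ Q.localRing.comap (pullback F n).toRingHom := by rw [h]; exact hf
    exact hf')

/-- The ramification index `e(Q|P)`: the largest `e` with `m_P O_Q ⊆ m_Q ^ e`. -/
def ramificationIndex {F : Type*} [Field F] {n : ℕ} {Q : Point F (n + 1)} {P : Point F n}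
    (h : Q.LiesOver P) : ℕ :=
  letI : Algebra P.localRing Q.localRing := (localHom h).toAlgebra
  Ideal.ramificationIdx' (IsLocalRing.maximalIdeal P.localRing)
    (IsLocalRing.maximalIdeal Q.localRing)

/-- The coefficient of `Q` in the ramification divisor of `C_{n+1}/C_n`: the length of the
`O_Q`-module of relative differentials `Ω_{O_Q/O_P}`. -/
def ramificationCoeff {F : Type*} [Field F] {n : ℕ} {Q : Point F (n + 1)} {P : Point F n}
    (h : Q.LiesOver P) : ℕ∞ :=
  letI : Algebra P.localRing Q.localRing := (localHom h).toAlgebra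
  Module.length Q.localRing (Ω[Q.localRing⁄P.localRing])

/-- `P` is totally ramified in `C_{n+1}/C_n`: there is exactly one point over `P`, and its
ramification index is the degree of the cover. -/
def IsTotallyRamified {F : Type*} [Field F] {n : ℕ} (P : Point F n) : Prop :=
  ∃ (Q : Point F (n + 1)) (h : Q.LiesOver P), (∀ Q' : Point F (n + 1), Q'.LiesOver P → Q' = Q) ∧
    ramificationIndex h = Module.finrank (functionField F n) (functionField F (n + 1))

/-- `P` is unramified in `C_{n+1}/C_n`: all points over `P` have ramification index `1`. The ground
field being algebraically closed, there is no condition on the residue fields. -/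
def IsUnramified {F : Type*} [Field F] {n : ℕ} (P : Point F n) : Prop :=
  ∀ (Q : Point F (n + 1)) (h : Q.LiesOver P), ramificationIndex h = 1

/-- `P` contributes `d` to the ramification divisor of `C_{n+1}/C_n`: the points over `P` have total
multiplicity `d` in it. -/
def Contributes {F : Type*} [Field F] {n : ℕ} (P : Point F n) (d : ℕ∞) : Prop :=
  ∑' Q : {Q : Point F (n + 1) // Q.LiesOver P}, ramificationCoeff Q.2 = d

end Point

end ASTower

end

/-! A quadratic extension w² + w = z in characteristic two is unramified at P if z can be made
regular by adding some y² + y. It is totally ramified with different exponent 2 if z can be reduced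
in this way to a simple pole. So everything depends on the shape of the polar part of z, not only on
its order, and that shape is followed up the tower.

Let ε denote primitive third roots of unity, which may vary from step to step. A twisted pole of
depth r is a simple pole to which y ↦ ε(y² + y) has been applied r times modulo regular functions.
An Artin-Schreier pole of depth r uses y ↦ (εy)² + εy instead. At depth 0 both are simple poles.

The depth builds up while the coordinates are finite. At a third root of unity x_k + 1 + 1/x_k
vanishes, so x_{k+1} is 0 or 1, and no depth is lost. If x_{k+1} = 1, put u = x_{k+1} + 1. Then
x_{k+2}² + x_{k+2} + 1 = u²/(1+u), so x_{k+2} is again a third root ε of unity, and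
x_{k+2}/(x_{k+2}² + x_{k+2} + 1) ≡ ε(u⁻² + u⁻¹): the depth grows by one. Hence a zero of x_i forces
i = 2m+1, and 1/x_i is a twisted pole of depth m (`pointType_of_hasIndexSequence`).

From there on each right hand side agrees with the last coordinate modulo regular functions, and the
depth is used up. If z ≡ ε(y² + y), then w + ε²y solves an Artin-Schreier equation with right hand
side ≡ y. By recursion a simple pole is reached: the step is ramified, and w is an Artin-Schreier
pole of the same depth (`IsTwistedPole.exists_simple_pole`). If z ≡ (εy)² + εy, the step is
unramified and w ≡ εy, a twisted pole of depth one less (`IsArtinSchreierPole.const_mul`). So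
ramified and unramified steps alternate until the depth is 0, after which every step is ramified
(`rhs_pole`). -/

namespace ASTower

/-! ### Leading terms and local parameters of a valuation ring -/

section Valuation

variable (F : Type*) {K L : Type*} [Field F] [Field K] [Field L] [Algebra F K] [Algebra F L]

/-- `f` has a leading term `c t ^ m` with respect to the valuation ring `V`. -/
def HasLeadingTerm (V : ValuationSubring K) (t f : K) : Prop :=
  ∃ (m : ℤ) (c : F) (g : K), c ≠ 0 ∧ V.valuation g < 1 ∧ f = algebraMap F K c * t ^ m * (1 + g)

/-- `t` is a uniformizer of the valuation ring `V`, whose residue field is `F`. -/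
structure IsLocalParam (V : ValuationSubring K) (t : K) : Prop where
  const_mem : ∀ c : F, algebraMap F K c ∈ V
  ne_zero : t ≠ 0
  lt_one : V.valuation t < 1
  lead : ∀ f, f ≠ 0 → HasLeadingTerm F V t f

variable {F}

theorem valuation_const {V : ValuationSubring K} (hV : ∀ c : F, algebraMap F K c ∈ V) {c : F}
    (hc : c ≠ 0) : V.valuation (algebraMap F K c) = 1 := by
  apply le_antisymm ((V.valuation_le_one_iff _).2 (hV c))
  have h := (V.valuation_le_one_iff _).2 (hV c⁻¹)
  rw [map_inv₀, map_inv₀] at h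
  have h0 : 0 < V.valuation (algebraMap F K c) := by
    rw [Valuation.pos_iff]; simpa using hc
  exact (inv_le_one₀ h0).1 h

theorem valuation_inv_lt_one {V : ValuationSubring K} {f : K} (h : f ∉ V) :
    V.valuation f⁻¹ < 1 := by
  rw [← V.valuation_le_one_iff, not_le] at h
  rw [map_inv₀]
  exact inv_lt_one_of_one_lt₀ h

theorem mem_of_valuation_lt_one {V : ValuationSubring K} {f : K} (h : V.valuation f < 1) :
    f ∈ V := (V.valuation_le_one_iff f).1 h.le

theorem valuation_mul_lt_one {V : ValuationSubring K} {f g : K} (hf : f ∈ V)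
    (hg : V.valuation g < 1) : V.valuation (f * g) < 1 := by
  rw [map_mul]
  exact mul_lt_one_of_nonneg_of_lt_one_right ((V.valuation_le_one_iff f).2 hf) zero_le hg

theorem not_mem_of_valuation_inv_lt_one {V : ValuationSubring K} {f : K} (h0 : f ≠ 0)
    (h : V.valuation f⁻¹ < 1) : f ∉ V := by
  intro hf
  have h1 := valuation_mul_lt_one hf h
  rw [mul_inv_cancel₀ h0, map_one] at h1
  exact lt_irrefl _ h1

theorem valuation_add_lt_one {V : ValuationSubring K} {f g : K} (hf : V.valuation f < 1)
    (hg : V.valuation g < 1) : V.valuation (f + g) < 1 :=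
  V.valuation.map_add_lt hf hg

theorem one_add_ne_zero {V : ValuationSubring K} {g : K} (hg : V.valuation g < 1) :
    1 + g ≠ 0 := by
  intro h
  have := V.valuation.map_one_add_of_lt hg
  rw [h, map_zero] at this
  exact zero_ne_one this

/-- A root of a monic quadratic polynomial `y² + y = c` over `V` lies in `V`. -/
theorem mem_of_sq_add_self_mem {V : ValuationSubring K} {y : K} (h : y ^ 2 + y ∈ V) : y ∈ V := by
  by_contra hy
  have h1 := valuation_inv_lt_one hy
  have hy0 : y ≠ 0 := by rintro rfl; exact hy V.zero_mem
  have h2 : y = (y ^ 2 + y) * y⁻¹ - 1 := by field_simp; ring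
  apply hy
  rw [h2]
  exact sub_mem (mul_mem h (mem_of_valuation_lt_one h1)) V.one_mem

namespace HasLeadingTerm

variable {V : ValuationSubring K} {t f g : K}

theorem const {c : F} (hc : c ≠ 0) : HasLeadingTerm F V t (algebraMap F K c) :=
  ⟨0, c, 0, hc, by simp, by simp⟩

theorem one_add (hg : V.valuation g < 1) : HasLeadingTerm F V t (1 + g) :=
  ⟨0, 1, g, one_ne_zero, hg, by simp⟩

theorem self : HasLeadingTerm F V t t := ⟨1, 1, 0, one_ne_zero, by simp, by simp⟩

theorem mul (ht : t ≠ 0) (hf : HasLeadingTerm F V t f) (hg : HasLeadingTerm F V t g) :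
    HasLeadingTerm F V t (f * g) := by
  obtain ⟨m, c, u, hc, hu, rfl⟩ := hf
  obtain ⟨n, d, w, hd, hw, rfl⟩ := hg
  refine ⟨m + n, c * d, u + w + u * w, mul_ne_zero hc hd, ?_, ?_⟩
  · exact valuation_add_lt_one (valuation_add_lt_one hu hw)
      (valuation_mul_lt_one (mem_of_valuation_lt_one hu) hw)
  · rw [zpow_add₀ ht, map_mul]; ring

theorem inv (hf : HasLeadingTerm F V t f) : HasLeadingTerm F V t f⁻¹ := by
  obtain ⟨m, c, u, hc, hu, rfl⟩ := hf
  refine ⟨-m, c⁻¹, -(u * (1 + u)⁻¹), inv_ne_zero hc, ?_, ?_⟩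
  · rw [Valuation.map_neg, map_mul, map_inv₀, V.valuation.map_one_add_of_lt hu]
    simpa using hu
  · have := one_add_ne_zero hu
    rw [mul_inv, mul_inv, zpow_neg, map_inv₀]
    congr 1
    field_simp
    ring

theorem pow (ht : t ≠ 0) (hf : HasLeadingTerm F V t f) (n : ℕ) : HasLeadingTerm F V t (f ^ n) := by
  induction n with
  | zero => simpa using one_add (F := F) (V := V) (t := t) (g := 0) (by simp)
  | succ n ih => rw [pow_succ]; exact ih.mul ht hf

theorem zpow (ht : t ≠ 0) (hf : HasLeadingTerm F V t f) (n : ℤ) :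
    HasLeadingTerm F V t (f ^ n) := by
  cases n with
  | ofNat n => simpa using hf.pow ht n
  | negSucc n => rw [zpow_negSucc]; exact (hf.pow ht _).inv

theorem add_of_lt (ht : t ≠ 0) (hf0 : f ≠ 0) (hf : HasLeadingTerm F V t f)
    (h : V.valuation g < V.valuation f) : HasLeadingTerm F V t (f + g) := by
  have : f + g = f * (1 + g / f) := by field_simp
  rw [this]
  refine hf.mul ht (one_add ?_)
  rw [map_div₀]
  exact (div_lt_one₀ (by rw [Valuation.pos_iff]; exact hf0)).2 h

end HasLeadingTerm

theorem valuation_leadingTerm {V : ValuationSubring K} (hV : ∀ c : F, algebraMap F K c ∈ V)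
    {t g : K} {m : ℤ} {c : F} (hc : c ≠ 0) (hg : V.valuation g < 1) :
    V.valuation (algebraMap F K c * t ^ m * (1 + g)) = V.valuation t ^ m := by
  rw [map_mul, map_mul, map_zpow₀, valuation_const hV hc, V.valuation.map_one_add_of_lt hg,
    one_mul, mul_one]

namespace IsLocalParam

variable {V : ValuationSubring K} {t : K}

theorem pos (h : IsLocalParam F V t) : 0 < V.valuation t := by
  rw [Valuation.pos_iff]; exact h.ne_zero

theorem zpow_inj (h : IsLocalParam F V t) {m n : ℤ} (e : V.valuation t ^ m = V.valuation t ^ n) :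
    m = n :=
  (zpow_right_strictAnti₀ h.pos h.lt_one).injective e

theorem zpow_le_one_iff (h : IsLocalParam F V t) {m : ℤ} : V.valuation t ^ m ≤ 1 ↔ 0 ≤ m := by
  rw [← zpow_zero (V.valuation t)]
  exact (zpow_right_strictAnti₀ h.pos h.lt_one).le_iff_ge

theorem zpow_lt_one_iff (h : IsLocalParam F V t) {m : ℤ} : V.valuation t ^ m < 1 ↔ 0 < m := by
  rw [← zpow_zero (V.valuation t)]
  exact (zpow_right_strictAnti₀ h.pos h.lt_one).lt_iff_gt

theorem exists_valuation_eq (h : IsLocalParam F V t) {f : K} (hf : f ≠ 0) :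
    ∃ m : ℤ, V.valuation f = V.valuation t ^ m := by
  obtain ⟨m, c, g, hc, hg, rfl⟩ := h.lead f hf
  exact ⟨m, valuation_leadingTerm h.const_mem hc hg⟩

theorem of_hasLeadingTerm (hV : ∀ c : F, algebraMap F K c ∈ V) (h : IsLocalParam F V t) {s : K}
    (hs : HasLeadingTerm F V s t) (hs0 : s ≠ 0) (hs1 : V.valuation s < 1) :
    IsLocalParam F V s := by
  refine ⟨hV, hs0, hs1, fun f hf => ?_⟩
  obtain ⟨m, c, g, hc, hg, rfl⟩ := h.lead f hf
  exact ((HasLeadingTerm.const hc).mul hs0 (hs.zpow hs0 m)).mul hs0 (HasLeadingTerm.one_add hg)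

theorem of_valuation_eq (h : IsLocalParam F V t) {s : K} (hs : V.valuation s = V.valuation t) :
    IsLocalParam F V s := by
  have hs0 : s ≠ 0 := by
    rw [← V.valuation.pos_iff, hs]; exact h.pos
  refine h.of_hasLeadingTerm h.const_mem ?_ hs0 (hs ▸ h.lt_one)
  obtain ⟨m, c, g, hc, hg, e⟩ := h.lead s hs0
  have hm : m = 1 := by
    apply h.zpow_inj
    rw [← valuation_leadingTerm (t := t) (m := m) h.const_mem hc hg, ← e, hs, zpow_one]
  subst hm
  have h1 := one_add_ne_zero hg
  have hc' : algebraMap F K c ≠ 0 := by simpa using hc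
  have : t = algebraMap F K c⁻¹ * (1 + g)⁻¹ * s := by
    rw [e, map_inv₀]; field_simp
  rw [this]
  exact ((HasLeadingTerm.const (inv_ne_zero hc)).mul hs0 (HasLeadingTerm.one_add hg).inv).mul hs0
    HasLeadingTerm.self

/-- Every element of `V` has a residue in `F`. -/
theorem exists_residue (h : IsLocalParam F V t) {f : K} (hf : f ∈ V) :
    ∃ c : F, V.valuation (f - algebraMap F K c) < 1 := by
  by_cases h0 : f = 0
  · exact ⟨0, by simp [h0]⟩
  obtain ⟨m, c, g, hc, hg, rfl⟩ := h.lead f h0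
  rw [← V.valuation_le_one_iff, valuation_leadingTerm h.const_mem hc hg, h.zpow_le_one_iff] at hf
  rcases hf.eq_or_lt with rfl | hm
  · refine ⟨c, ?_⟩
    have : algebraMap F K c * t ^ (0 : ℤ) * (1 + g) - algebraMap F K c = algebraMap F K c * g := by
      simp; ring
    rw [this]
    exact valuation_mul_lt_one (h.const_mem c) hg
  · refine ⟨0, ?_⟩
    rw [map_zero, sub_zero, valuation_leadingTerm h.const_mem hc hg]
    exact h.zpow_lt_one_iff.2 hm

end IsLocalParam

/-! ### Local parameters in quadratic Artin-Schreier extensions -/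

section Extension

variable [Algebra K L] [IsScalarTower F K L] {V : ValuationSubring K} {W : ValuationSubring L}

theorem algebraMap_mem_iff (h : W.comap (algebraMap K L) = V) {f : K} :
    algebraMap K L f ∈ W ↔ f ∈ V := by
  rw [← h]; rfl

theorem valuation_algebraMap_lt_one_iff (h : W.comap (algebraMap K L) = V) {f : K} :
    W.valuation (algebraMap K L f) < 1 ↔ V.valuation f < 1 := by
  rw [← ValuationSubring.mem_nonunits_iff, ← ValuationSubring.mem_nonunits_iff,
    ValuationSubring.mem_nonunits_iff_or, ValuationSubring.mem_nonunits_iff_or, ← map_inv₀,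
    algebraMap_mem_iff h, map_eq_zero]

theorem HasLeadingTerm.algebraMap (h : W.comap (algebraMap K L) = V) {t f : K}
    (hf : HasLeadingTerm F V t f) :
    HasLeadingTerm F W (algebraMap K L t) (algebraMap K L f) := by
  obtain ⟨m, c, g, hc, hg, rfl⟩ := hf
  refine ⟨m, c, _, hc, (valuation_algebraMap_lt_one_iff h).2 hg, ?_⟩
  simp [IsScalarTower.algebraMap_apply F K L]

theorem const_mem_extension (h : W.comap (algebraMap K L) = V)
    (hV : ∀ c : F, algebraMap F K c ∈ V) (c : F) : algebraMap F L c ∈ W := by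
  rw [IsScalarTower.algebraMap_apply F K L, algebraMap_mem_iff h]
  exact hV c

variable (K) in
/-- Every element of `L` is of the form `a + b w` with `a` and `b` in `K`. -/
def Generates (w : L) : Prop :=
  ∀ f : L, ∃ a b : K, f = algebraMap K L a + algebraMap K L b * w

theorem Generates.add {w : L} (hw : Generates K w) (c : K) :
    Generates K (w + algebraMap K L c) := by
  intro f
  obtain ⟨a, b, rfl⟩ := hw f
  exact ⟨a - b * c, b, by simp; ring⟩

/-- The conjugate of g = a + s is 1 + g, a unit with residue 1. So g equals its norm a² + a + c, an
element of K whose leading term is known, up to such a unit. -/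
theorem hasLeadingTerm_add_of_residue_zero [CharP K 2] [CharP L 2]
    (h : W.comap (algebraMap K L) = V) {t : K} (ht : IsLocalParam F V t) {a c : K} {s : L}
    (hs : s ^ 2 + s = algebraMap K L c) (hs1 : W.valuation s < 1) (ha : V.valuation a < 1)
    (h0 : algebraMap K L a + s ≠ 0) :
    HasLeadingTerm F W (algebraMap K L t) (algebraMap K L a + s) := by
  have h2 : (2 : L) = 0 := CharTwo.two_eq_zero
  set g := algebraMap K L a + s with hg
  have hg1 : W.valuation g < 1 :=
    valuation_add_lt_one ((valuation_algebraMap_lt_one_iff h).2 ha) hs1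
  have hd : g * (1 + g) = algebraMap K L (a ^ 2 + a + c) := by
    rw [map_add, map_add, map_pow, ← hs, hg]
    linear_combination (algebraMap K L a * s) * h2
  have h3 := one_add_ne_zero hg1
  have hd0 : a ^ 2 + a + c ≠ 0 := by
    intro e
    rw [e, map_zero] at hd
    exact mul_ne_zero h0 h3 hd
  have : g = algebraMap K L (a ^ 2 + a + c) * (1 + g)⁻¹ := by
    rw [← hd]; field_simp
  rw [this]
  exact ((ht.lead _ hd0).algebraMap h).mul (by simpa using ht.ne_zero)
    (HasLeadingTerm.one_add hg1).inv

omit [Algebra F L] [IsScalarTower F K L] in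
-- Subtracting from c its residue c₀ = s₀² + s₀ translates s by s₀. The new s₁ satisfies s₁(s₁ + 1)
-- = c - c₀, which vanishes at W, so s₁ or s₁ + 1 does.
theorem exists_generator_lt_one [IsAlgClosed F] [CharP K 2] [CharP L 2]
    (h : W.comap (algebraMap K L) = V) {t : K} (ht : IsLocalParam F V t) {c : K} (hc : c ∈ V)
    {s : L} (hs : s ^ 2 + s = algebraMap K L c) (hgen : Generates K s) :
    ∃ (c' : K) (s' : L), s' ^ 2 + s' = algebraMap K L c' ∧ W.valuation s' < 1 ∧
      Generates K s' := by
  have h2 : (2 : L) = 0 := CharTwo.two_eq_zero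
  have h2' : (2 : K) = 0 := CharTwo.two_eq_zero
  obtain ⟨c₀, hc₀⟩ := ht.exists_residue hc
  obtain ⟨s₀, hs₀⟩ := exists_artinSchreier_root c₀
  set s₁ := s + algebraMap K L (algebraMap F K s₀) with hs₁
  have e : s₁ ^ 2 + s₁ = algebraMap K L (c - algebraMap F K c₀) := by
    rw [← hs₀, map_sub, ← hs, hs₁]
    simp only [map_add, map_pow]
    linear_combination (s * algebraMap K L (algebraMap F K s₀) +
      algebraMap K L (algebraMap F K s₀) + algebraMap K L (algebraMap F K s₀) ^ 2) * h2
  have hlt := (valuation_algebraMap_lt_one_iff h).2 hc₀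
  by_cases h1 : W.valuation s₁ < 1
  · exact ⟨_, s₁, e, h1, hgen.add _⟩
  · refine ⟨c - algebraMap F K c₀, s₁ + algebraMap K L 1, ?_, ?_, (hgen.add _).add _⟩
    · rw [← e, map_one]; linear_combination (s₁ + 1) * h2
    · have e' : (s₁ + algebraMap K L 1) * s₁ = algebraMap K L (c - algebraMap F K c₀) := by
        rw [← e, map_one]; ring
      rw [← e', map_mul] at hlt
      by_contra h3
      exact absurd hlt (not_lt.2 (one_le_mul (not_lt.1 h3) (not_lt.1 h1)))

/-- Artin-Schreier extensions with a regular right hand side are unramified. -/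
theorem IsLocalParam.algebraMap_of_unramified [IsAlgClosed F] [CharP K 2] [CharP L 2]
    (h : W.comap (algebraMap K L) = V) {t : K} (ht : IsLocalParam F V t) {c : K} (hc : c ∈ V)
    {s : L} (hs : s ^ 2 + s = algebraMap K L c) (hgen : Generates K s) :
    IsLocalParam F W (algebraMap K L t) := by
  obtain ⟨c, s, hs, hs1, hgen⟩ := exists_generator_lt_one h ht hc hs hgen
  have ht0 : algebraMap K L t ≠ 0 := by simpa using ht.ne_zero
  have key : ∀ a : K, algebraMap K L a + s ≠ 0 →
      HasLeadingTerm F W (algebraMap K L t) (algebraMap K L a + s) := by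
    intro a h0
    -- Only a vanishing a needs the norm argument. A nonzero residue or a pole of a dominates s,
    -- which vanishes at W.
    by_cases ha : a ∈ V
    · obtain ⟨a₀, ha₀⟩ := ht.exists_residue ha
      by_cases hz : a₀ = 0
      · rw [hz, map_zero, sub_zero] at ha₀
        exact hasLeadingTerm_add_of_residue_zero h ht hs hs1 ha₀ h0
      · have := (HasLeadingTerm.const (F := F) (V := W) (t := algebraMap K L t) hz).add_of_lt ht0
          (by simpa using hz) (g := algebraMap K L (a - algebraMap F K a₀) + s) (by
            rw [valuation_const (const_mem_extension h ht.const_mem) hz]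
            exact valuation_add_lt_one ((valuation_algebraMap_lt_one_iff h).2 ha₀) hs1)
        convert this using 1
        rw [map_sub, IsScalarTower.algebraMap_apply F K L]
        ring
    · have ha0 : a ≠ 0 := by rintro rfl; exact ha V.zero_mem
      refine ((ht.lead a ha0).algebraMap h).add_of_lt ht0 (by simpa using ha0) ?_
      refine hs1.trans ?_
      rw [← not_le, W.valuation_le_one_iff, algebraMap_mem_iff h]
      exact ha
  refine ⟨const_mem_extension h ht.const_mem, ht0, (valuation_algebraMap_lt_one_iff h).2 ht.lt_one,
    fun f hf => ?_⟩
  obtain ⟨a, b, rfl⟩ := hgen f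
  by_cases hb : b = 0
  · subst hb
    simp only [map_zero, zero_mul, add_zero] at hf ⊢
    exact (ht.lead a (by simpa using hf)).algebraMap h
  · have hb' : algebraMap K L b ≠ 0 := by simpa using hb
    have e : algebraMap K L a + algebraMap K L b * s =
        algebraMap K L b * (algebraMap K L (a / b) + s) := by
      rw [map_div₀]; field_simp
    rw [e] at hf ⊢
    exact ((ht.lead b hb).algebraMap h).mul ht0 (key _ (right_ne_zero_of_mul hf))

section Ramified

variable {A : K} {w : L} (h : W.comap (algebraMap K L) = V) (hA : IsLocalParam F V A⁻¹)
  (hw : w ^ 2 + w = algebraMap K L A)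

include h hA hw

omit [Algebra F L] [IsScalarTower F K L] in
theorem not_mem_of_simple_pole : w ∉ W := by
  intro hm
  have : algebraMap K L A ∈ W := by rw [← hw]; exact add_mem (pow_mem hm 2) hm
  rw [algebraMap_mem_iff h] at this
  exact not_mem_of_valuation_inv_lt_one (by simpa using hA.ne_zero) hA.lt_one this

omit [Algebra F L] [IsScalarTower F K L] in
theorem ne_zero_of_simple_pole : w ≠ 0 := by
  rintro rfl
  exact not_mem_of_simple_pole h hA hw W.zero_mem

omit [Algebra F L] [IsScalarTower F K L] in
theorem valuation_inv_generator_lt_one : W.valuation w⁻¹ < 1 :=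
  valuation_inv_lt_one (not_mem_of_simple_pole h hA hw)

omit [Algebra F L] [IsScalarTower F K L] in
theorem algebraMap_inv_eq :
    algebraMap K L A⁻¹ = w⁻¹ ^ 2 * (1 + w⁻¹)⁻¹ := by
  have h0 := ne_zero_of_simple_pole h hA hw
  have h1 := one_add_ne_zero (valuation_inv_generator_lt_one h hA hw)
  rw [map_inv₀, ← hw]
  have h3 : w ^ 2 + w = w ^ 2 * (1 + w⁻¹) := by field_simp
  rw [h3, mul_inv, inv_pow]

omit [Algebra F L] [IsScalarTower F K L] in
theorem valuation_algebraMap_inv :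
    W.valuation (algebraMap K L A⁻¹) = W.valuation w⁻¹ ^ 2 := by
  rw [algebraMap_inv_eq h hA hw, map_mul, map_inv₀ _ (1 + w⁻¹),
    W.valuation.map_one_add_of_lt (valuation_inv_generator_lt_one h hA hw), map_pow, inv_one,
    mul_one]

theorem exists_valuation_algebraMap {b : K} (hb : b ≠ 0) :
    ∃ m : ℤ, V.valuation b = V.valuation A⁻¹ ^ m ∧
      W.valuation (algebraMap K L b) = W.valuation w⁻¹ ^ (2 * m) := by
  obtain ⟨m, c, g, hc, hg, rfl⟩ := hA.lead b hb
  refine ⟨m, valuation_leadingTerm hA.const_mem hc hg, ?_⟩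
  have e : algebraMap K L (algebraMap F K c * A⁻¹ ^ m * (1 + g)) =
      algebraMap F L c * algebraMap K L A⁻¹ ^ m * (1 + algebraMap K L g) := by
    simp [IsScalarTower.algebraMap_apply F K L]
  rw [e, valuation_leadingTerm (const_mem_extension h hA.const_mem) hc
      ((valuation_algebraMap_lt_one_iff h).2 hg), valuation_algebraMap_inv h hA hw, zpow_mul]
  rfl

/-- Parity: measured by w⁻¹, elements of K have even order, because A⁻¹ has order 2, while w has
order -1. -/
theorem valuation_ne_of_ne_zero {a b : K} (ha : a ≠ 0) (hb : b ≠ 0) :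
    W.valuation (algebraMap K L a) ≠ W.valuation (algebraMap K L b * w) := by
  obtain ⟨m, -, hm⟩ := exists_valuation_algebraMap h hA hw ha
  obtain ⟨n, -, hn⟩ := exists_valuation_algebraMap h hA hw hb
  have h0 : 0 < W.valuation w⁻¹ := by
    rw [Valuation.pos_iff]; exact inv_ne_zero (ne_zero_of_simple_pole h hA hw)
  have h1 : W.valuation w = W.valuation w⁻¹ ^ (-1 : ℤ) := by simp
  rw [map_mul, hm, hn, h1, ← zpow_add₀ h0.ne']
  intro e
  have := (zpow_right_strictAnti₀ h0 (valuation_inv_generator_lt_one h hA hw)).injective e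
  omega

/-- Artin-Schreier extensions whose right hand side has a simple pole are ramified. -/
theorem isLocalParam_inv_of_simple_pole (hgen : Generates K w) : IsLocalParam F W w⁻¹ := by
  have h0 : w⁻¹ ≠ 0 := inv_ne_zero (ne_zero_of_simple_pole h hA hw)
  have h1 := valuation_inv_generator_lt_one h hA hw
  have hlt : HasLeadingTerm F W w⁻¹ (algebraMap K L A⁻¹) := by
    rw [algebraMap_inv_eq h hA hw]
    exact (HasLeadingTerm.self.pow h0 2).mul h0 (HasLeadingTerm.one_add h1).inv
  have hK : ∀ a : K, a ≠ 0 → HasLeadingTerm F W w⁻¹ (algebraMap K L a) := by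
    intro a ha
    obtain ⟨m, c, g, hc, hg, rfl⟩ := hA.lead a ha
    rw [map_mul, map_mul, map_zpow₀, ← IsScalarTower.algebraMap_apply F K L, map_add, map_one]
    exact ((HasLeadingTerm.const hc).mul h0 (hlt.zpow h0 m)).mul h0
      (HasLeadingTerm.one_add ((valuation_algebraMap_lt_one_iff h).2 hg))
  have hself : HasLeadingTerm F W w⁻¹ w := by
    simpa using (HasLeadingTerm.self (F := F) (V := W) (t := w⁻¹)).inv
  refine ⟨const_mem_extension h hA.const_mem, h0, h1, fun f hf => ?_⟩
  obtain ⟨a, b, rfl⟩ := hgen f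
  by_cases ha : a = 0
  · subst ha
    by_cases hb : b = 0
    · simp [hb] at hf
    · simpa using (hK b hb).mul h0 hself
  by_cases hb : b = 0
  · simpa [hb] using hK a ha
  have hbw : algebraMap K L b * w ≠ 0 :=
    mul_ne_zero (by simpa using hb) (ne_zero_of_simple_pole h hA hw)
  rcases (valuation_ne_of_ne_zero h hA hw ha hb).lt_or_gt with hl | hl
  · rw [add_comm]
    exact ((hK b hb).mul h0 hself).add_of_lt h0 hbw hl
  · exact (hK a ha).add_of_lt h0 (by simpa using ha) hl

/-- By parity no cancellation is possible between a and bw, so each must be regular. The criterion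
mentions only V, and therefore also shows that W is the only extension of V. -/
theorem mem_iff_of_simple_pole {a b : K} :
    algebraMap K L a + algebraMap K L b * w ∈ W ↔ a ∈ V ∧ V.valuation b < 1 := by
  have h0 : 0 < W.valuation w⁻¹ := by
    rw [Valuation.pos_iff]; exact inv_ne_zero (ne_zero_of_simple_pole h hA hw)
  have hlt := valuation_inv_generator_lt_one h hA hw
  have hbw : algebraMap K L b * w ∈ W ↔ V.valuation b < 1 := by
    by_cases hb : b = 0
    · simp [hb]
    obtain ⟨m, hm, hm'⟩ := exists_valuation_algebraMap h hA hw hb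
    have h1 : W.valuation w = W.valuation w⁻¹ ^ (-1 : ℤ) := by simp
    rw [← W.valuation_le_one_iff, map_mul, hm, hm', h1, ← zpow_add₀ h0.ne', hA.zpow_lt_one_iff,
      ← zpow_zero (W.valuation w⁻¹), (zpow_right_strictAnti₀ h0 hlt).le_iff_ge]
    omega
  rw [← hbw, ← algebraMap_mem_iff h]
  refine ⟨fun hm => ?_, fun hm => add_mem hm.1 hm.2⟩
  by_cases ha : a = 0
  · subst ha; simpa using hm
  by_cases hb : b = 0
  · subst hb; simpa using hm
  have hne := valuation_ne_of_ne_zero h hA hw ha hb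
  rw [← W.valuation_le_one_iff, Valuation.map_add_of_distinct_val _ hne] at hm
  rw [← W.valuation_le_one_iff, ← W.valuation_le_one_iff]
  exact max_le_iff.1 hm

end Ramified

theorem eq_of_simple_pole {W' : ValuationSubring L} {A : K} {w : L}
    (h : W.comap (algebraMap K L) = V) (h' : W'.comap (algebraMap K L) = V)
    (hA : IsLocalParam F V A⁻¹) (hw : w ^ 2 + w = algebraMap K L A) (hgen : Generates K w) :
    W' = W := by
  ext f
  obtain ⟨a, b, rfl⟩ := hgen f
  rw [mem_iff_of_simple_pole h hA hw, mem_iff_of_simple_pole h' hA hw]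

end Extension

end Valuation

/-! ### Twisted poles and Artin-Schreier poles -/

section Poles

variable (F : Type*) {K L : Type*} [Field F] [Field K] [Field L] [Algebra F K] [Algebra F L]

/-- `z` is obtained from a function with a simple pole by `r` twisted Artin-Schreier operators
`y ↦ ε (y² + y)`, with `ε` a primitive third root of unity, modulo regular functions. -/
def IsTwistedPole (V : ValuationSubring K) : ℕ → K → Prop
  | 0, z => IsLocalParam F V z⁻¹
  | r + 1, z => ∃ ε : F, ε ^ 2 + ε + 1 = 0 ∧ ∃ y, IsTwistedPole V r y ∧
      z - algebraMap F K ε * (y ^ 2 + y) ∈ V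

/-- `z` is obtained from a function with a simple pole by `r` operators `y ↦ (ε y)² + ε y`, with `ε`
a primitive third root of unity, modulo regular functions. -/
def IsArtinSchreierPole (V : ValuationSubring K) : ℕ → K → Prop
  | 0, z => IsLocalParam F V z⁻¹
  | r + 1, z => ∃ ε : F, ε ^ 2 + ε + 1 = 0 ∧ ∃ y, IsArtinSchreierPole V r y ∧
      z - ((algebraMap F K ε * y) ^ 2 + algebraMap F K ε * y) ∈ V

variable {F}

theorem thirdRoot_ne_zero {ε : F} (h : ε ^ 2 + ε + 1 = 0) : ε ≠ 0 := by
  rintro rfl; simp at h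

variable {V : ValuationSubring K}

theorem IsLocalParam.inv_of_sub_mem {z z' : K} (h : IsLocalParam F V z⁻¹) (hz : z - z' ∈ V) :
    IsLocalParam F V z'⁻¹ := by
  refine h.of_valuation_eq ?_
  have h1 : z ∉ V :=
    not_mem_of_valuation_inv_lt_one (by simpa using h.ne_zero) h.lt_one
  rw [← V.valuation_le_one_iff, not_le] at h1
  rw [← V.valuation_le_one_iff] at hz
  have : z' = z + -(z - z') := by ring
  rw [map_inv₀, map_inv₀]
  congr 1
  rw [this]
  apply Valuation.map_add_eq_of_lt_left
  rw [Valuation.map_neg]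
  exact hz.trans_lt h1

theorem IsLocalParam.inv_const_mul {z : K} (h : IsLocalParam F V z⁻¹) {ε : F} (hε : ε ≠ 0) :
    IsLocalParam F V (algebraMap F K ε * z)⁻¹ := by
  refine h.of_valuation_eq ?_
  rw [map_inv₀, map_inv₀, map_mul, valuation_const h.const_mem hε, one_mul]

namespace IsTwistedPole

theorem of_sub_mem {r : ℕ} {z z' : K} (h : IsTwistedPole F V r z) (hz : z - z' ∈ V) :
    IsTwistedPole F V r z' := by
  cases r with
  | zero => exact IsLocalParam.inv_of_sub_mem h hz
  | succ r =>
    obtain ⟨ε, hε, y, hy, e⟩ := h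
    refine ⟨ε, hε, y, hy, ?_⟩
    convert sub_mem e hz using 1
    ring

theorem exists_isLocalParam {r : ℕ} {z : K} (h : IsTwistedPole F V r z) :
    ∃ t : K, IsLocalParam F V t := by
  induction r generalizing z with
  | zero => exact ⟨_, h⟩
  | succ r ih =>
    obtain ⟨ε, hε, y, hy, e⟩ := h
    exact ih hy

theorem not_mem {r : ℕ} {z : K} (h : IsTwistedPole F V r z) : z ∉ V := by
  obtain ⟨t, ht⟩ := h.exists_isLocalParam
  induction r generalizing z with
  | zero => exact not_mem_of_valuation_inv_lt_one (by simpa using h.ne_zero) h.lt_one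
  | succ r ih =>
    obtain ⟨ε, hε, y, hy, e⟩ := h
    intro hz
    apply ih hy
    apply mem_of_sq_add_self_mem
    have h1 : algebraMap F K ε * (y ^ 2 + y) ∈ V := by
      convert sub_mem hz e using 1; ring
    have h2 := mul_mem (ht.const_mem ε⁻¹) h1
    rw [← mul_assoc, ← map_mul, inv_mul_cancel₀ (thirdRoot_ne_zero hε), map_one, one_mul] at h2
    exact h2

theorem extend [Algebra K L] [IsScalarTower F K L] {W : ValuationSubring L}
    (h : W.comap (algebraMap K L) = V)
    (hW : ∀ t, IsLocalParam F V t → IsLocalParam F W (algebraMap K L t)) {r : ℕ} {z : K}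
    (hz : IsTwistedPole F V r z) : IsTwistedPole F W r (algebraMap K L z) := by
  induction r generalizing z with
  | zero => simpa using! hW _ hz
  | succ r ih =>
    obtain ⟨ε, hε, y, hy, e⟩ := hz
    refine ⟨ε, hε, _, ih hy, ?_⟩
    rw [← algebraMap_mem_iff h] at e
    simpa [IsScalarTower.algebraMap_apply F K L] using e

end IsTwistedPole

namespace IsArtinSchreierPole

theorem of_sub_mem {r : ℕ} {z z' : K} (h : IsArtinSchreierPole F V r z) (hz : z - z' ∈ V) :
    IsArtinSchreierPole F V r z' := by
  cases r with
  | zero => exact IsLocalParam.inv_of_sub_mem h hz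
  | succ r =>
    obtain ⟨ε, hε, y, hy, e⟩ := h
    refine ⟨ε, hε, y, hy, ?_⟩
    convert sub_mem e hz using 1
    ring

/-- Regrouping the constants: if y ≡ (δw)² + δw, then εy ≡ ε((δw)² + δw), and δw is a twisted pole
by induction. -/
theorem const_mul {r : ℕ} {y : K} (h : IsArtinSchreierPole F V r y) {ε : F}
    (hε : ε ^ 2 + ε + 1 = 0) : IsTwistedPole F V r (algebraMap F K ε * y) := by
  induction r generalizing y ε with
  | zero => exact IsLocalParam.inv_const_mul h (thirdRoot_ne_zero hε)
  | succ r ih =>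
    obtain ⟨δ, hδ, w, hw, e⟩ := h
    have h1 := ih hw hδ
    obtain ⟨t, ht⟩ := h1.exists_isLocalParam
    refine ⟨ε, hε, _, h1, ?_⟩
    convert mul_mem (ht.const_mem ε) e using 1
    ring

theorem not_mem {r : ℕ} {y : K} (h : IsArtinSchreierPole F V r y) : y ∉ V := by
  cases r with
  | zero => exact not_mem_of_valuation_inv_lt_one (by simpa using h.ne_zero) h.lt_one
  | succ r =>
    obtain ⟨δ, hδ, w, hw, e⟩ := h
    intro hy
    apply (hw.const_mul hδ).not_mem
    apply mem_of_sq_add_self_mem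
    convert sub_mem hy e using 1
    ring

end IsArtinSchreierPole

theorem const_sq_add_self [CharP K 2] {ε : F} (hε : ε ^ 2 + ε + 1 = 0) :
    algebraMap F K ε ^ 2 + algebraMap F K ε = 1 := by
  have h := congrArg (algebraMap F K) hε
  simp only [map_add, map_pow, map_one, map_zero] at h
  linear_combination h - CharTwo.two_eq_zero (R := K)

/-- A quadratic Artin-Schreier extension whose right hand side is a twisted pole can be generated
by an Artin-Schreier equation whose right hand side has a simple pole. -/
theorem IsTwistedPole.exists_simple_pole [Algebra K L] [IsScalarTower F K L] [CharP K 2]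
    [CharP L 2] {r : ℕ} {z : K} (h : IsTwistedPole F V r z) {w : L} {c : K} (hc : c ∈ V)
    (hw : w ^ 2 + w = algebraMap K L (z + c)) (hgen : Generates K w) :
    ∃ (w₀ : L) (A : K), IsLocalParam F V A⁻¹ ∧ w₀ ^ 2 + w₀ = algebraMap K L A ∧
      Generates K w₀ ∧ ∀ W : ValuationSubring L, W.comap (algebraMap K L) = V →
        IsLocalParam F W w₀⁻¹ → IsArtinSchreierPole F W r w := by
  have h2 : (2 : L) = 0 := CharTwo.two_eq_zero
  induction r generalizing z w c with
  | zero =>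
    refine ⟨w, z + c, IsLocalParam.inv_of_sub_mem h ?_, hw, hgen, fun W _ hW => hW⟩
    simpa using hc
  | succ r ih =>
    obtain ⟨ε, hε, y, hy, e⟩ := h
    obtain ⟨t, ht⟩ := hy.exists_isLocalParam
    have hεK := const_sq_add_self (K := K) hε
    have hεL := congrArg (algebraMap K L) hεK
    set a := algebraMap F K ε with ha
    simp only [map_add, map_pow, map_one] at hεL
    set b := algebraMap K L a with hb
    set Y := algebraMap K L y with hY
    have hd : c + (z - a * (y ^ 2 + y)) ∈ V := add_mem hc e
    -- Let d = c + z - a(y² + y), a regular function. As a + a² = 1 and a⁴ = a, the translate w' = w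
    -- + a²y satisfies w'² + w' = a(y² + y) + d + ay² + a²y = y + d.
    obtain ⟨w₀, A, hA, hw₀, hgen₀, H⟩ := ih hy (w := w + algebraMap K L (a ^ 2 * y)) hd
      (by
        simp only [map_add, map_sub, map_mul, map_pow, ← hb, ← hY] at hw ⊢
        linear_combination hw + (w * b ^ 2 * Y + b * (b + 1) * (1 - b) * Y ^ 2) * h2 +
          (b * (b + 1) * Y ^ 2 + Y) * hεL)
      (hgen.add _)
    refine ⟨w₀, A, hA, hw₀, hgen₀, fun W hW hW₀ => ?_⟩
    refine ⟨ε, hε, _, H W hW hW₀, ?_⟩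
    rw [IsScalarTower.algebraMap_apply F K L, ← ha, ← hb, map_mul, map_pow, ← hb, ← hY]
    -- Substituting y = w'² + w' + d in w = w' + a²y and using 1 + a² = a gives w = (aw')² + aw' +
    -- a²d, with regular remainder a²d.
    have hm : algebraMap K L (a ^ 2 * (c + (z - a * (y ^ 2 + y)))) ∈ W := by
      rw [algebraMap_mem_iff hW]
      exact mul_mem (pow_mem (ht.const_mem ε) 2) hd
    convert hm using 1
    simp only [map_add, map_sub, map_mul, map_pow, ← hb, ← hY] at hw ⊢
    linear_combination b ^ 2 * hw +
      (-b ^ 2 * w ^ 2 - b ^ 4 * w * Y - b ^ 3 * (b - 1) * Y ^ 2) * h2 +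
      (-w - b ^ 3 * (b - 1) * Y ^ 2) * hεL

end Poles

/-! ### Ramification index and differentials of a quadratic extension of rings -/

section Quadratic

variable {R S : Type*} [CommRing R] [CommRing S] [Algebra R S]

theorem ramificationIdx_eq_of_uniformizers [IsDomain S] [IsLocalRing R] [IsLocalRing S] {t : R}
    {π u : S} (ht : IsLocalRing.maximalIdeal R = Ideal.span {t})
    (hπ : IsLocalRing.maximalIdeal S = Ideal.span {π}) (hπ0 : π ≠ 0) (hu : IsUnit u) {e : ℕ}
    (h : algebraMap R S t = u * π ^ e) :
    Ideal.ramificationIdx' (IsLocalRing.maximalIdeal R) (IsLocalRing.maximalIdeal S) = e := by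
  rw [ht, hπ]
  apply Ideal.ramificationIdx'_spec
  · rw [Ideal.map_span, Set.image_singleton, Ideal.span_singleton_pow,
      Ideal.span_singleton_le_span_singleton, h]
    exact Dvd.intro_left _ rfl
  · rw [Ideal.map_span, Set.image_singleton, Ideal.span_singleton_pow,
      Ideal.span_singleton_le_span_singleton, h]
    rintro ⟨c, hc⟩
    have h1 : u = π * c := by
      apply mul_right_cancel₀ (pow_ne_zero e hπ0)
      rw [hc]; ring
    have h2 : IsUnit π := isUnit_of_mul_isUnit_left (h1 ▸ hu)
    have h3 : π ∈ IsLocalRing.maximalIdeal S := hπ ▸ Ideal.mem_span_singleton_self π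
    exact (IsLocalRing.mem_maximalIdeal _).1 h3 h2

variable {π : S} {B : R} (h2 : (2 : S) = 0)
  (hπ : π ^ 2 + algebraMap R S B * π + algebraMap R S B = 0)
  (hex : ∀ s : S, ∃ a b : R, s = algebraMap R S a + algebraMap R S b * π)
  (huniq : ∀ a b : R, algebraMap R S a + algebraMap R S b * π = 0 → a = 0 ∧ b = 0)

include h2 hπ hex huniq

/-- In the quadratic extension `S = R[π]` with `π² + B π + B = 0` in characteristic two, there is a
derivation `a + b π ↦ b` into `S / B`. -/
theorem exists_derivation_quotient : ∃ D : Derivation R S (S ⧸ Ideal.span {algebraMap R S B}),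
    D π = 1 := by
  choose α β hαβ using hex
  have huniq' : ∀ s a b, s = algebraMap R S a + algebraMap R S b * π → α s = a ∧ β s = b := by
    intro s a b hs
    have := huniq (α s - a) (β s - b) (by
      rw [map_sub, map_sub]; linear_combination hs - hαβ s)
    exact ⟨sub_eq_zero.1 this.1, sub_eq_zero.1 this.2⟩
  let q := Ideal.Quotient.mk (Ideal.span {algebraMap R S B})
  have hq : q (algebraMap R S B) = 0 :=
    Ideal.Quotient.eq_zero_iff_mem.2 (Ideal.mem_span_singleton_self _)
  have hq2 : (2 : S ⧸ Ideal.span {algebraMap R S B}) = 0 := by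
    rw [← map_ofNat q 2, h2, map_zero]
  let f : S →ₗ[R] S ⧸ Ideal.span {algebraMap R S B} :=
    { toFun := fun s => q (algebraMap R S (β s))
      map_add' := fun s s' => by
        have := (huniq' (s + s') (α s + α s') (β s + β s') (by
          rw [map_add, map_add]; linear_combination hαβ s + hαβ s')).2
        rw [this, map_add, map_add]
      map_smul' := fun r s => by
        have := (huniq' (r • s) (r * α s) (r * β s) (by
          rw [Algebra.smul_def, map_mul, map_mul]
          linear_combination algebraMap R S r * hαβ s)).2
        rw [this, map_mul, map_mul, RingHom.id_apply, Algebra.smul_def]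
        rfl }
  have hf : ∀ s, f s = q (algebraMap R S (β s)) := fun _ => rfl
  refine ⟨Derivation.mk' f ?_, ?_⟩
  · intro s s'
    have h1 := (huniq' (s * s') (α s * α s' - β s * β s' * B)
      (α s * β s' + α s' * β s - β s * β s' * B) (by
        simp only [map_add, map_sub, map_mul]
        linear_combination s' * hαβ s +
          (algebraMap R S (α s) + algebraMap R S (β s) * π) * hαβ s' +
          algebraMap R S (β s) * algebraMap R S (β s') * hπ)).2
    rw [Algebra.smul_def, Algebra.smul_def, hf, hf, hf, h1]
    change _ = q s * _ + q s' * _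
    have e1 := congrArg q (hαβ s)
    have e2 := congrArg q (hαβ s')
    simp only [map_add, map_mul, map_sub, hq] at e1 e2 ⊢
    rw [e1, e2]
    -- The two sides of the Leibniz rule differ by 2ββ'π, once B = 0 in the quotient has removed the
    -- contribution of π².
    linear_combination (-q (algebraMap R S (β s)) * q (algebraMap R S (β s')) * q π) * hq2
  · have := (huniq' π 0 1 (by simp)).2
    change q (algebraMap R S (β π)) = 1
    rw [this]; simp

/-- The module is generated by dπ, and differentiating the equation of π gives B dπ = 0 because 2 =
0. The derivation with values in S/B shows that there is no further relation. -/
theorem length_kaehlerDifferential_quadratic : Module.length S (Ω[S⁄R]) =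
    Module.length S (S ⧸ Ideal.span {algebraMap R S B}) := by
  obtain ⟨D, hD⟩ := exists_derivation_quotient h2 hπ hex huniq
  let d := KaehlerDifferential.D R S
  have hB : algebraMap R S B • d π = 0 := by
    have := congrArg d hπ
    rw [map_add, map_add, Derivation.leibniz_pow, Derivation.leibniz, Derivation.map_algebraMap,
      map_zero] at this
    simp only [smul_zero, add_zero] at this
    rw [two_nsmul, ← two_smul S, h2, zero_smul, zero_add] at this
    exact this
  let g : S →ₗ[S] Ω[S⁄R] := LinearMap.toSpanSingleton S _ (d π)
  let G : (S ⧸ Ideal.span {algebraMap R S B}) →ₗ[S] Ω[S⁄R] :=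
    Submodule.liftQ _ g (by
      rw [Ideal.span, Submodule.span_le, Set.singleton_subset_iff]
      exact hB)
  have hG : ∀ s : S, G (Ideal.Quotient.mk _ s) = s • d π := fun s => rfl
  refine (LinearEquiv.ofBijective G ⟨?_, ?_⟩).length_eq.symm
  · have hl : ∀ y, D.liftKaehlerDifferential (G y) = y := by
      intro y
      obtain ⟨s, rfl⟩ := Ideal.Quotient.mk_surjective y
      rw [hG, map_smul, Derivation.liftKaehlerDifferential_comp_D, hD, Algebra.smul_def, mul_one]
      rfl
    exact Function.LeftInverse.injective hl
  · rw [← LinearMap.range_eq_top, eq_top_iff, ← KaehlerDifferential.span_range_derivation R S,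
      Submodule.span_le]
    rintro _ ⟨s, rfl⟩
    obtain ⟨a, b, rfl⟩ := hex s
    refine ⟨Ideal.Quotient.mk _ (algebraMap R S b), ?_⟩
    rw [hG, map_add, Derivation.leibniz, Derivation.map_algebraMap, Derivation.map_algebraMap]
    simp [d]

end Quadratic

/-! ### Local rings with a local parameter and their quadratic extensions -/

section LocalParam

variable {F K : Type*} [Field F] [Field K] [Algebra F K] {V : ValuationSubring K} {t : K}

theorem IsLocalParam.dvd_iff (h : IsLocalParam F V t) {f : V} :
    (⟨t, mem_of_valuation_lt_one h.lt_one⟩ : V) ∣ f ↔ V.valuation (f : K) < 1 := by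
  constructor
  · rintro ⟨g, rfl⟩
    rw [mul_comm]
    exact valuation_mul_lt_one g.2 h.lt_one
  · intro hf
    by_cases h0 : (f : K) = 0
    · rw [Subtype.ext (a1 := f) (a2 := 0) h0]; exact dvd_zero _
    obtain ⟨m, hm⟩ := h.exists_valuation_eq h0
    rw [hm, h.zpow_lt_one_iff] at hf
    have : (f : K) * t⁻¹ ∈ V := by
      rw [← V.valuation_le_one_iff, map_mul, map_inv₀, hm, ← zpow_neg_one, ← zpow_add₀ h.pos.ne',
        h.zpow_le_one_iff]
      omega
    refine ⟨⟨_, this⟩, Subtype.ext ?_⟩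
    have := h.ne_zero
    change (f : K) = t * (f * t⁻¹)
    field_simp

theorem IsLocalParam.maximalIdeal_eq (h : IsLocalParam F V t) :
    IsLocalRing.maximalIdeal V = Ideal.span {⟨t, mem_of_valuation_lt_one h.lt_one⟩} := by
  ext f
  rw [V.valuation_lt_one_iff, Ideal.mem_span_singleton, h.dvd_iff]

theorem IsLocalParam.isDiscreteValuationRing (h : IsLocalParam F V t) :
    IsDiscreteValuationRing V := by
  have hm : (⟨t, mem_of_valuation_lt_one h.lt_one⟩ : V) ≠ 0 := fun e =>
    h.ne_zero (congrArg Subtype.val e)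
  apply IsDiscreteValuationRing.ofHasUnitMulPowIrreducibleFactorization
  refine ⟨⟨t, mem_of_valuation_lt_one h.lt_one⟩, ?_, ?_⟩
  · apply Prime.irreducible
    rw [← Ideal.span_singleton_prime hm, ← h.maximalIdeal_eq]
    infer_instance
  · intro x hx
    have hx0 : (x : K) ≠ 0 := fun e => hx (Subtype.ext e)
    obtain ⟨m, hm⟩ := h.exists_valuation_eq hx0
    have hm0 : 0 ≤ m := by
      rw [← h.zpow_le_one_iff, ← hm]; exact V.valuation_le_one x
    obtain ⟨n, rfl⟩ := Int.eq_ofNat_of_zero_le hm0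
    refine ⟨n, ?_⟩
    have e : V.valuation (x : K) = V.valuation (t ^ n) := by
      rw [hm, map_pow]; exact zpow_natCast _ _
    obtain ⟨a, ha⟩ := (V.valuation_eq_iff _ _).1 e
    refine ⟨a, Subtype.ext ?_⟩
    rw [← ha, mul_comm]
    rfl

end LocalParam

section LocalExtension

variable {F K L : Type*} [Field F] [Field K] [Field L] [Algebra F K] [Algebra F L] [Algebra K L]
  [IsScalarTower F K L] {V : ValuationSubring K} {W : ValuationSubring L} [Algebra V W]

omit [IsScalarTower F K L] in
theorem ramificationIdx_eq_one (hVW : ∀ f : V, (algebraMap V W f : L) = algebraMap K L f) {t : K}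
    (ht : IsLocalParam F V t) (ht' : IsLocalParam F W (algebraMap K L t)) :
    Ideal.ramificationIdx' (IsLocalRing.maximalIdeal V) (IsLocalRing.maximalIdeal W) = 1 := by
  refine ramificationIdx_eq_of_uniformizers ht.maximalIdeal_eq ht'.maximalIdeal_eq
    (fun e => ht'.ne_zero (congrArg Subtype.val e)) isUnit_one ?_
  rw [one_mul, pow_one]
  exact Subtype.ext (hVW _)

variable {A : K} {w : L} (h : W.comap (algebraMap K L) = V) (hA : IsLocalParam F V A⁻¹)
  (hw : w ^ 2 + w = algebraMap K L A)

include h hA hw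

omit [Algebra V W] in
theorem eq_zero_of_add_mul_eq_zero {a b : K} (e : algebraMap K L a + algebraMap K L b * w = 0) :
    a = 0 ∧ b = 0 := by
  have h0 := ne_zero_of_simple_pole h hA hw
  by_cases ha : a = 0
  · subst ha; simpa [h0] using e
  by_cases hb : b = 0
  · subst hb; simpa using e
  refine absurd ?_ (valuation_ne_of_ne_zero h hA hw ha hb)
  rw [eq_neg_of_add_eq_zero_left e, Valuation.map_neg]

omit [Algebra V W] in
theorem finrank_eq_two (hgen : Generates K w) : Module.finrank K L = 2 := by
  let f : (K × K) →ₗ[K] L :=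
    (LinearMap.toSpanSingleton K L 1).coprod (LinearMap.toSpanSingleton K L w)
  have hf : ∀ a b, f (a, b) = algebraMap K L a + algebraMap K L b * w := by
    intro a b; simp [f, Algebra.smul_def]
  have hb : Function.Bijective f := by
    constructor
    · rw [injective_iff_map_eq_zero]
      rintro ⟨a, b⟩ e
      rw [hf] at e
      obtain ⟨rfl, rfl⟩ := eq_zero_of_add_mul_eq_zero h hA hw e
      rfl
    · intro y
      obtain ⟨a, b, rfl⟩ := hgen y
      exact ⟨(a, b), hf a b⟩
  rw [← (LinearEquiv.ofBijective f hb).finrank_eq]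
  simp

theorem exists_unit_mul_sq (hVW : ∀ f : V, (algebraMap V W f : L) = algebraMap K L f)
    (hgen : Generates K w) :
    ∃ u : W, IsUnit u ∧ algebraMap V W ⟨A⁻¹, mem_of_valuation_lt_one hA.lt_one⟩ = u *
      ⟨w⁻¹, mem_of_valuation_lt_one (isLocalParam_inv_of_simple_pole h hA hw hgen).lt_one⟩ ^ 2 := by
  have h1 := valuation_inv_generator_lt_one h hA hw
  have hv := W.valuation.map_one_add_of_lt h1
  have hu : W.valuation (1 + w⁻¹)⁻¹ = 1 := by rw [map_inv₀, hv, inv_one]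
  refine ⟨⟨(1 + w⁻¹)⁻¹, (W.valuation_le_one_iff _).1 hu.le⟩, (W.valuation_eq_one_iff _).2 hu,
    Subtype.ext ?_⟩
  rw [hVW]
  change algebraMap K L A⁻¹ = (1 + w⁻¹)⁻¹ * w⁻¹ ^ 2
  rw [algebraMap_inv_eq h hA hw, mul_comm]

theorem ramificationIdx_eq_two (hVW : ∀ f : V, (algebraMap V W f : L) = algebraMap K L f)
    (hgen : Generates K w) :
    Ideal.ramificationIdx' (IsLocalRing.maximalIdeal V) (IsLocalRing.maximalIdeal W) = 2 := by
  obtain ⟨u, hu, e⟩ := exists_unit_mul_sq h hA hw hVW hgen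
  have hp := isLocalParam_inv_of_simple_pole h hA hw hgen
  exact ramificationIdx_eq_of_uniformizers hA.maximalIdeal_eq hp.maximalIdeal_eq
    (fun e => hp.ne_zero (congrArg Subtype.val e)) hu e

/-- W = V[w⁻¹]: if a + bw is regular, then b = A⁻¹c with c in V, and c = b(w² + w) gives bw = cw⁻¹ -
b. -/
theorem exists_eq_add_mul_inv (hVW : ∀ f : V, (algebraMap V W f : L) = algebraMap K L f)
    (hgen : Generates K w) (s : W) : ∃ a b : V, s = algebraMap V W a + algebraMap V W b *
      ⟨w⁻¹, mem_of_valuation_lt_one (isLocalParam_inv_of_simple_pole h hA hw hgen).lt_one⟩ := by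
  have h0 := ne_zero_of_simple_pole h hA hw
  obtain ⟨a, b, e⟩ := hgen s
  have hs : (s : L) ∈ W := s.2
  rw [e, mem_iff_of_simple_pole h hA hw] at hs
  obtain ⟨c, hc⟩ := hA.dvd_iff (f := ⟨b, mem_of_valuation_lt_one hs.2⟩) |>.2 hs.2
  have hc' : b = A⁻¹ * c := congrArg Subtype.val hc
  have hA0 : A ≠ 0 := by simpa using hA.ne_zero
  refine ⟨⟨a, hs.1⟩ - ⟨b, mem_of_valuation_lt_one hs.2⟩, c, Subtype.ext ?_⟩
  rw [e, map_sub]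
  change _ = ((algebraMap V W ⟨a, hs.1⟩ : W) : L) - (algebraMap V W ⟨b, _⟩ : W) +
    (algebraMap V W c : W) * w⁻¹
  rw [hVW, hVW, hVW]
  have h3 : algebraMap K L c = algebraMap K L b * (w ^ 2 + w) := by
    rw [hw, ← map_mul, hc']; congr 1; field_simp
  rw [h3]
  field_simp
  ring

/-- With π = w⁻¹ and B = A⁻¹ the equation of w becomes π² + Bπ + B = 0. Here B is a unit times π²,
so W/B has length 2. -/
theorem length_kaehlerDifferential_eq_two [CharP L 2]
    (hVW : ∀ f : V, (algebraMap V W f : L) = algebraMap K L f) (hgen : Generates K w) :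
    Module.length W (Ω[W⁄V]) = 2 := by
  have h0 := ne_zero_of_simple_pole h hA hw
  have hA0 : A ≠ 0 := by simpa using hA.ne_zero
  have hp := isLocalParam_inv_of_simple_pole h hA hw hgen
  obtain ⟨u, hu, e⟩ := exists_unit_mul_sq h hA hw hVW hgen
  have h2 : (2 : L) = 0 := CharTwo.two_eq_zero
  rw [length_kaehlerDifferential_quadratic (B := ⟨A⁻¹, mem_of_valuation_lt_one hA.lt_one⟩)
    (π := ⟨w⁻¹, mem_of_valuation_lt_one hp.lt_one⟩) (Subtype.ext h2) ?_
    (exists_eq_add_mul_inv h hA hw hVW hgen) ?_]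
  · have := hp.isDiscreteValuationRing
    rw [e, Ideal.span_singleton_mul_left_unit hu, ← Ideal.span_singleton_pow, ← hp.maximalIdeal_eq,
      IsDiscreteValuationRing.length_quotient_pow_maximalIdeal]
    rfl
  · apply Subtype.ext
    change w⁻¹ ^ 2 + (algebraMap V W _ : W) * w⁻¹ + (algebraMap V W _ : W) = 0
    rw [hVW]
    change w⁻¹ ^ 2 + algebraMap K L A⁻¹ * w⁻¹ + algebraMap K L A⁻¹ = 0
    have h1 := one_add_ne_zero hp.lt_one
    rw [algebraMap_inv_eq h hA hw]
    have : w⁻¹ ^ 2 + w⁻¹ ^ 2 * (1 + w⁻¹)⁻¹ * w⁻¹ + w⁻¹ ^ 2 * (1 + w⁻¹)⁻¹ =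
      w⁻¹ ^ 2 * (1 + (1 + w⁻¹) * (1 + w⁻¹)⁻¹) := by ring
    rw [this, mul_inv_cancel₀ h1]
    linear_combination w⁻¹ ^ 2 * h2
  · intro a b hab
    have h3 : ((algebraMap V W a : W) : L) + (algebraMap V W b : W) * w⁻¹ = 0 :=
      congrArg Subtype.val hab
    rw [hVW, hVW] at h3
    have h4 : algebraMap K L b + algebraMap K L a * w = 0 := by
      field_simp at h3
      linear_combination h3
    obtain ⟨hb, ha⟩ := eq_zero_of_add_mul_eq_zero h hA hw h4
    exact ⟨Subtype.ext ha, Subtype.ext hb⟩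

end LocalExtension

/-- Take a valuation ring W dominating the image of V. If φ f lies in W but f not in V, then f⁻¹ is
in V and becomes a unit of W; by domination it is already a unit of V, so f is in V after all. -/
theorem exists_valuationSubring_comap_eq {K L : Type*} [Field K] [Field L] (φ : K →+* L)
    (V : ValuationSubring K) : ∃ W : ValuationSubring L, W.comap φ = V := by
  obtain ⟨W, hW⟩ := (V.toLocalSubring.map φ).exists_le_valuationSubring
  obtain ⟨hle, hloc⟩ := LocalSubring.le_def.1 hW
  have hmem : ∀ f ∈ V, φ f ∈ W := fun f hf => hle ⟨f, hf, rfl⟩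
  refine ⟨W, ValuationSubring.ext _ _ fun f => ⟨fun hf => ?_, fun hf => hmem f hf⟩⟩
  have hf' : φ f ∈ W := hf
  rcases V.mem_or_inv_mem f with h | h
  · exact h
  by_cases h0 : f = 0
  · rw [h0]; exact V.zero_mem
  have hφ : φ f ≠ 0 := by simpa using h0
  let g : (V.toLocalSubring.map φ).toSubring := ⟨φ f⁻¹, f⁻¹, h, rfl⟩
  have hu : IsUnit (Subring.inclusion hle g) := by
    refine IsUnit.of_mul_eq_one (⟨φ f, hf'⟩ : W.toLocalSubring.toSubring) (Subtype.ext ?_)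
    change φ f⁻¹ * φ f = 1
    rw [map_inv₀, inv_mul_cancel₀ hφ]
  obtain ⟨⟨_, k, hk, rfl⟩, hg⟩ := (isUnit_iff_exists_inv.1 (hloc.map_nonunit g hu))
  have hg' : φ f⁻¹ * φ k = 1 := congrArg Subtype.val hg
  have : f = k := by
    apply φ.injective
    rw [map_inv₀] at hg'
    field_simp at hg'
    exact hg'.symm
  rw [this]; exact hk

/-! ### The function fields of the tower and their points -/

section Tower

variable {F : Type*} [Field F]

instance (n : ℕ) : IsScalarTower F (functionField F n) (functionField F (n + 1)) :=
  IsScalarTower.of_algebraMap_eq fun _ => rfl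

instance [CharP F 2] (n : ℕ) : CharP (functionField F n) 2 :=
  charP_of_injective_algebraMap (algebraMap F (functionField F n)).injective 2

/-- The right hand side of the equation defining `C_{n+1}` over `C_n`. -/
noncomputable def rhs (F : Type*) [Field F] (n : ℕ) : functionField F n :=
  coord F n n le_rfl + 1 + (coord F n n le_rfl)⁻¹

/-- The last coordinate function on `C_n`. -/
noncomputable def last (F : Type*) [Field F] (n : ℕ) : functionField F n := coord F n n le_rfl

theorem rhs_eq (n : ℕ) : rhs F n = last F n + 1 + (last F n)⁻¹ := rfl

theorem last_succ (n : ℕ) : last F (n + 1) ^ 2 + last F (n + 1) =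
    algebraMap (functionField F n) (functionField F (n + 1)) (rhs F n) :=
  Subtype.ext (x_succ F n)

theorem generates_last [CharP F 2] (n : ℕ) : Generates (functionField F n) (last F (n + 1)) := by
  have h2 : (2 : Ambient F) = 0 := by
    have : CharP (Ambient F) 2 :=
      charP_of_injective_algebraMap (algebraMap F (Ambient F)).injective 2
    exact CharTwo.two_eq_zero
  let X := x F (n + 1)
  let c : functionField F n := rhs F n
  have hX : X ^ 2 + X = c := x_succ F n
  have key : ∀ y ∈ functionField F (n + 1), ∃ a b : functionField F n, y = a + b * X := by
    intro y hy
    induction hy using IntermediateField.adjoin_induction with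
    | mem y hy =>
      obtain ⟨k, hk, rfl⟩ := hy
      rcases Nat.lt_or_ge n k with h | h
      · obtain rfl : k = n + 1 := le_antisymm hk h
        exact ⟨0, 1, by simp [X]⟩
      · exact ⟨⟨_, x_mem_functionField F h⟩, 0, by simp⟩
    | algebraMap r => exact ⟨algebraMap F _ r, 0, by simp⟩
    | add y z _ _ hy hz =>
      obtain ⟨a, b, rfl⟩ := hy
      obtain ⟨a', b', rfl⟩ := hz
      exact ⟨a + a', b + b', by push_cast; ring⟩
    | mul y z _ _ hy hz =>
      obtain ⟨a, b, rfl⟩ := hy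
      obtain ⟨a', b', rfl⟩ := hz
      refine ⟨a * a' + b * b' * c, a * b' + a' * b - b * b', ?_⟩
      push_cast
      linear_combination (b : Ambient F) * b' * hX
    | inv y _ hy =>
      obtain ⟨a, b, rfl⟩ := hy
      by_cases h0 : (a : Ambient F) + b * X + b = 0
      · refine ⟨b⁻¹, 0, ?_⟩
        have : (a : Ambient F) + b * X = b := by linear_combination h0 - b * h2
        rw [this]; simp
      by_cases h1 : (a : Ambient F) + b * X = 0
      · exact ⟨0, 0, by simp [h1]⟩
      -- The conjugate of a + bX is a + bX + b, and their product is the norm a² + ab + b²c.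
      · refine ⟨(a + b) * (a ^ 2 + a * b + b ^ 2 * c)⁻¹, b * (a ^ 2 + a * b + b ^ 2 * c)⁻¹, ?_⟩
        have hN : (a : Ambient F) ^ 2 + a * b + b ^ 2 * c = (a + b * X) * (a + b * X + b) := by
          rw [← hX]; linear_combination (-(a : Ambient F) * b * X) * h2
        push_cast
        rw [hN]
        field_simp
        ring
  intro f
  obtain ⟨a, b, h⟩ := key f f.2
  exact ⟨a, b, Subtype.ext h⟩

theorem last_zero_ne_const (c : F) : last F 0 ≠ algebraMap F _ c := by
  intro h
  have h1 : x F 0 = algebraMap F (Ambient F) c := congrArg Subtype.val h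
  rw [x_zero, IsScalarTower.algebraMap_apply F (RatFunc F) (Ambient F)] at h1
  have h3 := (algebraMap (RatFunc F) (Ambient F)).injective h1
  rw [IsScalarTower.algebraMap_apply F (Polynomial F) (RatFunc F), ← RatFunc.algebraMap_X] at h3
  exact Polynomial.X_ne_C c (RatFunc.algebraMap_injective F h3)

theorem exists_eq_aeval_div (f : functionField F 0) :
    ∃ p q : Polynomial F, f = Polynomial.aeval (last F 0) p / Polynomial.aeval (last F 0) q := by
  have hf : (f : Ambient F) ∈ IntermediateField.adjoin F (x F '' Set.Iic 0) := f.2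
  have hs : x F '' Set.Iic 0 = {x F 0} := by
    ext y; simp [eq_comm]
  rw [hs, IntermediateField.mem_adjoin_simple_iff] at hf
  obtain ⟨p, q, h⟩ := hf
  have he : ∀ p : Polynomial F, ((Polynomial.aeval (last F 0) p : functionField F 0) : Ambient F) =
      Polynomial.aeval (x F 0) p := fun p =>
    (Polynomial.aeval_algHom_apply (functionField F 0).val (last F 0) p).symm
  refine ⟨p, q, Subtype.ext ?_⟩
  rw [h, ← he, ← he]
  rfl

/-- A polynomial in x₀ is a power of x₀ - c times a polynomial not vanishing at c, and the value of
the latter at c is its leading coefficient here. -/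
theorem isLocalParam_last_zero_sub (P : Point F 0) {c : F}
    (h : P.localRing.valuation (last F 0 - algebraMap F _ c) < 1) :
    IsLocalParam F P.localRing (last F 0 - algebraMap F _ c) := by
  set t := last F 0 - algebraMap F (functionField F 0) c with ht
  have ht0 : t ≠ 0 := sub_ne_zero.2 (last_zero_ne_const c)
  have hX : last F 0 ∈ P.localRing := by
    have : last F 0 = t + algebraMap F _ c := by rw [ht]; ring
    rw [this]
    exact add_mem (mem_of_valuation_lt_one h) (P.algebraMap_mem c)
  have hpoly : ∀ p : Polynomial F, Polynomial.aeval (last F 0) p ∈ P.localRing := by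
    intro p
    induction p using Polynomial.induction_on with
    | C a => simpa using P.algebraMap_mem a
    | add p q hp hq => rw [map_add]; exact add_mem hp hq
    | monomial n a _ =>
      rw [map_mul, map_pow, Polynomial.aeval_X, Polynomial.aeval_C]
      exact mul_mem (P.algebraMap_mem a) (pow_mem hX _)
  have haev : Polynomial.aeval (last F 0) (Polynomial.X - Polynomial.C c) = t := by simp [ht]
  have hlead : ∀ p : Polynomial F, p ≠ 0 →
      HasLeadingTerm F P.localRing t (Polynomial.aeval (last F 0) p) := by
    intro p hp
    obtain ⟨q, hq, hdvd⟩ := Polynomial.exists_eq_pow_rootMultiplicity_mul_and_not_dvd p hp c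
    rw [hq, map_mul, map_pow, haev]
    refine (HasLeadingTerm.self.pow ht0 _).mul ht0 ?_
    have he : q.eval c ≠ 0 := by rwa [Polynomial.dvd_iff_isRoot] at hdvd
    obtain ⟨r, hr⟩ := Polynomial.X_sub_C_dvd_sub_C_eval (a := c) (p := q)
    have hq' : Polynomial.aeval (last F 0) q =
        algebraMap F _ (q.eval c) + t * Polynomial.aeval (last F 0) r := by
      rw [← haev, ← map_mul, ← hr]; simp
    rw [hq']
    refine (HasLeadingTerm.const he).add_of_lt ht0 (by simpa using he) ?_
    rw [valuation_const P.algebraMap_mem he, mul_comm]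
    exact valuation_mul_lt_one (hpoly r) h
  refine ⟨P.algebraMap_mem, ht0, h, fun f hf => ?_⟩
  obtain ⟨p, q, rfl⟩ := exists_eq_aeval_div f
  have hp : p ≠ 0 := by rintro rfl; simp at hf
  have hq : q ≠ 0 := by rintro rfl; simp at hf
  rw [div_eq_mul_inv]
  exact (hlead p hp).mul ht0 (hlead q hq).inv

namespace Point

variable {n : ℕ}

theorem LiesOver.comap_eq {Q : Point F (n + 1)} {P : Point F n} (h : Q.LiesOver P) :
    Q.localRing.comap (algebraMap (functionField F n) (functionField F (n + 1))) = P.localRing :=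
  h

theorem exists_liesOver (P : Point F n) : ∃ Q : Point F (n + 1), Q.LiesOver P := by
  obtain ⟨W, hW⟩ := exists_valuationSubring_comap_eq
    (algebraMap (functionField F n) (functionField F (n + 1))) P.localRing
  refine ⟨⟨W, const_mem_extension hW P.algebraMap_mem, ?_⟩, hW⟩
  rintro rfl
  apply P.ne_top
  rw [← hW]
  rfl

/-- The restricted valuation ring is proper: if it contained all functions on C_n, then Q's ring
would contain x_{n+1}, which is integral over them, and hence everything. -/
theorem exists_image [CharP F 2] (Q : Point F (n + 1)) : ∃ P : Point F n, Q.LiesOver P := by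
  refine ⟨⟨Q.localRing.comap (algebraMap (functionField F n) (functionField F (n + 1))),
    fun c => ?_, ?_⟩, rfl⟩
  · rw [ValuationSubring.mem_comap, ← IsScalarTower.algebraMap_apply]
    exact Q.algebraMap_mem c
  intro htop
  have hK : ∀ f : functionField F n, algebraMap _ (functionField F (n + 1)) f ∈ Q.localRing := by
    intro f
    rw [← ValuationSubring.mem_comap, htop]
    exact ValuationSubring.mem_top f
  apply Q.ne_top
  refine ValuationSubring.ext _ _ fun f => ⟨fun _ => ValuationSubring.mem_top f, fun _ => ?_⟩
  obtain ⟨a, b, rfl⟩ := generates_last n f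
  refine add_mem (hK a) (mul_mem (hK b) (mem_of_sq_add_self_mem ?_))
  rw [last_succ]
  exact hK _

theorem coe_localHom {Q : Point F (n + 1)} {P : Point F n} (h : Q.LiesOver P) (f : P.localRing) :
    (localHom h f : functionField F (n + 1)) = algebraMap (functionField F n) _ f := rfl

theorem ramificationIndex_eq_one {Q : Point F (n + 1)} {P : Point F n} (h : Q.LiesOver P)
    {t : functionField F n} (ht : IsLocalParam F P.localRing t)
    (ht' : IsLocalParam F Q.localRing (algebraMap _ (functionField F (n + 1)) t)) :
    ramificationIndex h = 1 := by
  let i : Algebra P.localRing Q.localRing := (localHom h).toAlgebra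
  exact ramificationIdx_eq_one (coe_localHom h) ht ht'

variable [CharP F 2]

theorem ramified_of_simple_pole {P : Point F n} {A : functionField F n}
    {w : functionField F (n + 1)} (hA : IsLocalParam F P.localRing A⁻¹)
    (hw : w ^ 2 + w = algebraMap _ (functionField F (n + 1)) A)
    (hgen : Generates (functionField F n) w) : P.IsTotallyRamified ∧ P.Contributes 2 := by
  obtain ⟨Q, h⟩ := P.exists_liesOver
  have huniq : ∀ Q' : Point F (n + 1), Q'.LiesOver P → Q' = Q := fun Q' h' =>
    Point.ext (eq_of_simple_pole h.comap_eq h'.comap_eq hA hw hgen)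
  let i : Algebra P.localRing Q.localRing := (localHom h).toAlgebra
  refine ⟨⟨Q, h, huniq, ?_⟩, ?_⟩
  · rw [finrank_eq_two h.comap_eq hA hw hgen]
    exact ramificationIdx_eq_two h.comap_eq hA hw (coe_localHom h) hgen
  · have : Unique {Q : Point F (n + 1) // Q.LiesOver P} :=
      ⟨⟨⟨Q, h⟩⟩, fun Q' => Subtype.ext (huniq Q'.1 Q'.2)⟩
    rw [Contributes, tsum_eq_single ⟨Q, h⟩ fun Q' hQ' =>
      absurd (Subtype.ext (huniq Q'.1 Q'.2)) hQ']
    exact length_kaehlerDifferential_eq_two h.comap_eq hA hw (coe_localHom h) hgen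

theorem ramified_of_isTwistedPole {P : Point F n} {r : ℕ}
    (hz : IsTwistedPole F P.localRing r (rhs F n)) :
    (P.IsTotallyRamified ∧ P.Contributes 2) ∧ ∀ Q : Point F (n + 1), Q.LiesOver P →
      IsArtinSchreierPole F Q.localRing r (last F (n + 1)) := by
  obtain ⟨w, A, hA, hw, hgen, H⟩ := hz.exists_simple_pole (w := last F (n + 1))
    (zero_mem P.localRing) (by rw [add_zero]; exact last_succ n) (generates_last n)
  exact ⟨ramified_of_simple_pole hA hw hgen, fun Q h =>
    H _ h.comap_eq (isLocalParam_inv_of_simple_pole h.comap_eq hA hw hgen)⟩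

/-- The translate x_{n+1} - y satisfies an Artin-Schreier equation with regular right hand side, so
it is itself regular and generates an unramified extension. -/
theorem unramified_of_sub_mem [IsAlgClosed F] {P : Point F n} {y : functionField F n}
    (hy : rhs F n - (y ^ 2 + y) ∈ P.localRing) {Q : Point F (n + 1)} (h : Q.LiesOver P) :
    (∀ t, IsLocalParam F P.localRing t → IsLocalParam F Q.localRing (algebraMap _ _ t)) ∧
      last F (n + 1) - algebraMap _ _ y ∈ Q.localRing := by
  have hs : (last F (n + 1) + algebraMap (functionField F n) (functionField F (n + 1)) (-y)) ^ 2 +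
      (last F (n + 1) + algebraMap (functionField F n) (functionField F (n + 1)) (-y)) =
      algebraMap _ _ (rhs F n - (y ^ 2 + y)) := by
    have h2 : (2 : functionField F (n + 1)) = 0 := CharTwo.two_eq_zero
    rw [map_sub, ← last_succ, map_add, map_pow, map_neg]
    linear_combination (-last F (n + 1) * algebraMap (functionField F n) _ y +
      algebraMap (functionField F n) _ y ^ 2) * h2
  refine ⟨fun t ht => ht.algebraMap_of_unramified h.comap_eq hy hs ((generates_last n).add _), ?_⟩
  have : last F (n + 1) + algebraMap (functionField F n) (functionField F (n + 1)) (-y) ∈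
      Q.localRing := by
    apply mem_of_sq_add_self_mem
    rw [hs, algebraMap_mem_iff h.comap_eq]
    exact hy
  simpa [sub_eq_add_neg] using this

/-- The right hand side is (εy)² + εy modulo regular functions, so x_{n+1} ≡ εy. This is where one
unit of depth is lost. -/
theorem unramified_of_isArtinSchreierPole [IsAlgClosed F] {P : Point F n} {r : ℕ}
    (hz : IsArtinSchreierPole F P.localRing (r + 1) (rhs F n)) :
    P.IsUnramified ∧ ∀ Q : Point F (n + 1), Q.LiesOver P →
      IsTwistedPole F Q.localRing r (last F (n + 1)) := by
  obtain ⟨ε, hε, y, hy, e⟩ := hz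
  have hT := hy.const_mul hε
  obtain ⟨t, ht⟩ := hT.exists_isLocalParam
  refine ⟨fun Q h => ?_, fun Q h => ?_⟩
  · exact ramificationIndex_eq_one h ht ((unramified_of_sub_mem e h).1 t ht)
  · obtain ⟨h1, h2⟩ := unramified_of_sub_mem e h
    refine (hT.extend h.comap_eq h1).of_sub_mem ?_
    rw [← neg_mem_iff, neg_sub]
    exact h2

end Point

end Tower

/-! ### Points above a third root of unity: growth and consumption of the depth -/

variable {F : Type*} [Field F]

theorem valuation_eq_one_of_sub_lt_one {K : Type*} [Field K] [Algebra F K]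
    {V : ValuationSubring K} (hV : ∀ c : F, algebraMap F K c ∈ V) {f : K} {c : F} (hc : c ≠ 0)
    (h : V.valuation (f - algebraMap F K c) < 1) : V.valuation f = 1 := by
  have h1 := valuation_const hV hc
  have : f = algebraMap F K c + (f - algebraMap F K c) := by ring
  rw [this, Valuation.map_add_eq_of_lt_left, h1]
  rwa [h1]

/-- The behaviour of the points of `C_n` at which `x₀` is a primitive third root of unity. -/
inductive PointType {n : ℕ} (P : Point F n) : Prop
  | thirdRoot (hn : Even n) (ε : F) (hε : ε ^ 2 + ε + 1 = 0)
      (h : P.localRing.valuation (last F n - algebraMap F _ ε) < 1)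
      (hp : IsTwistedPole F P.localRing (n / 2) (last F n / (last F n ^ 2 + last F n + 1)))
  | one (hn : Odd n) (h : P.localRing.valuation (last F n + 1) < 1)
      (hp : IsTwistedPole F P.localRing (n / 2) (last F n + 1)⁻¹)
  | zero (hn : Odd n) (h : P.localRing.valuation (last F n) < 1)
      (hp : IsTwistedPole F P.localRing (n / 2) (last F n)⁻¹)
  | pole (h : last F n ∉ P.localRing)

theorem rhs_sub_last_mem {n : ℕ} {P : Point F n} (h : last F n ∉ P.localRing) :
    rhs F n - last F n ∈ P.localRing := by
  have : rhs F n - last F n = 1 + (last F n)⁻¹ := by rw [rhs_eq]; ring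
  rw [this]
  exact add_mem (one_mem _) (mem_of_valuation_lt_one (valuation_inv_lt_one h))

theorem last_succ_not_mem {n : ℕ} {P : Point F n} {Q : Point F (n + 1)} (h : Q.LiesOver P)
    (hz : rhs F n ∉ P.localRing) : last F (n + 1) ∉ Q.localRing := by
  intro hm
  apply hz
  rw [← algebraMap_mem_iff h.comap_eq, ← last_succ]
  exact add_mem (pow_mem hm 2) hm

theorem thirdRoot_factor {K : Type*} [Field K] [Algebra F K] {ε : F} (hε : ε ^ 2 + ε + 1 = 0)
    (y : K) : y ^ 2 + y + 1 =
      (y - algebraMap F K ε) * ((y - algebraMap F K ε) + algebraMap F K (2 * ε + 1)) := by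
  have h := congrArg (algebraMap F K) hε
  simp only [map_add, map_pow, map_one, map_zero, map_mul, map_ofNat] at h ⊢
  linear_combination h

theorem Point.HasIndexSequence.image {n : ℕ} {Q : Point F (n + 1)} {P : Point F n}
    (h : Q.LiesOver P) {a : ℕ → OnePoint F} (hQ : Q.HasIndexSequence a) :
    P.HasIndexSequence a := by
  intro k hk
  have hk' := hQ k (hk.trans n.le_succ)
  have e : coord F (n + 1) k (hk.trans n.le_succ) =
    algebraMap _ (functionField F (n + 1)) (coord F n k hk) := rfl
  induction hak : a k using OnePoint.rec with
  | infty =>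
    rw [hak] at hk'
    change coord F (n + 1) k _ ∉ Q.localRing at hk'
    rwa [e, algebraMap_mem_iff h.comap_eq] at hk'
  | coe c =>
    rw [hak] at hk'
    change Q.localRing.valuation (coord F (n + 1) k _ - algebraMap F _ c) < 1 at hk'
    rwa [e, IsScalarTower.algebraMap_apply F (functionField F n) (functionField F (n + 1)),
      ← map_sub, valuation_algebraMap_lt_one_iff h.comap_eq] at hk'

variable [CharP F 2]

theorem valuation_thirdRoot_factor {n : ℕ} (P : Point F n) {ε : F} {y : functionField F n}
    (h : P.localRing.valuation (y - algebraMap F _ ε) < 1) :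
    P.localRing.valuation ((y - algebraMap F _ ε) + algebraMap F _ (2 * ε + 1)) = 1 := by
  have h2 : (2 : F) = 0 := CharTwo.two_eq_zero
  rw [h2, zero_mul, zero_add, map_one, add_comm]
  exact Valuation.map_one_add_of_lt _ h

/-- In characteristic two x₀² + x₀ + 1 = (x₀ - ε)(x₀ - ε + 1), and only the first factor vanishes,
to first order. -/
theorem pointType_zero (P : Point F 0) {ε : F} (hε : ε ^ 2 + ε + 1 = 0)
    (h : P.localRing.valuation (last F 0 - algebraMap F _ ε) < 1) : PointType P := by
  refine .thirdRoot Even.zero ε hε h ?_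
  change IsLocalParam F _ _
  refine (isLocalParam_last_zero_sub P h).of_valuation_eq ?_
  rw [inv_div, thirdRoot_factor hε, map_div₀, map_mul, valuation_thirdRoot_factor P h,
    valuation_eq_one_of_sub_lt_one P.algebraMap_mem (thirdRoot_ne_zero hε) h, mul_one, div_one]

/-- The function X = x_{n+1} satisfies X(X + 1) = z with z = x_n + 1 + 1/x_n vanishing at P. So the
step is unramified, and X or X + 1 vanishes at Q. In 1/z = 1/X + 1/(X + 1) one summand is regular,
so the other inherits the twisted pole 1/z. -/
theorem pointType_succ_of_thirdRoot [IsAlgClosed F] {n : ℕ} {P : Point F n} {Q : Point F (n + 1)}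
    (h : Q.LiesOver P) (hn : Even n) {ε : F} (hε : ε ^ 2 + ε + 1 = 0)
    (hv : P.localRing.valuation (last F n - algebraMap F _ ε) < 1)
    (hp : IsTwistedPole F P.localRing (n / 2) (last F n / (last F n ^ 2 + last F n + 1))) :
    PointType Q := by
  have h2 : (2 : functionField F (n + 1)) = 0 := CharTwo.two_eq_zero
  have hlast := valuation_eq_one_of_sub_lt_one P.algebraMap_mem (thirdRoot_ne_zero hε) hv
  have hlast0 : last F n ≠ 0 := by
    rw [← P.localRing.valuation.ne_zero_iff, hlast]; exact one_ne_zero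
  have hz : rhs F n = (last F n / (last F n ^ 2 + last F n + 1))⁻¹ := by
    rw [rhs_eq, inv_div]; field_simp
  rw [← inv_inv (last F n / _), ← hz] at hp
  have hz1 : P.localRing.valuation (rhs F n) < 1 := by
    have := valuation_inv_lt_one hp.not_mem
    rwa [inv_inv] at this
  have hz0 : rhs F n ≠ 0 := by
    intro e
    apply hp.not_mem
    rw [e, inv_zero]; exact zero_mem _
  have hy : rhs F n - (0 ^ 2 + 0) ∈ P.localRing := by
    simpa using mem_of_valuation_lt_one hz1
  have hp' := hp.extend h.comap_eq (Point.unramified_of_sub_mem hy h).1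
  have hz1' := (valuation_algebraMap_lt_one_iff h.comap_eq).2 hz1
  have hn' : (n + 1) / 2 = n / 2 := by
    obtain ⟨m, rfl⟩ := hn; omega
  have hz0' : algebraMap _ (functionField F (n + 1)) (rhs F n) ≠ 0 := by simpa using hz0
  set X := last F (n + 1) with hX
  have hXz : X * (X + 1) = algebraMap _ (functionField F (n + 1)) (rhs F n) := by
    rw [← last_succ]; ring
  have hX0 : X ≠ 0 := left_ne_zero_of_mul (hXz ▸ hz0')
  have hX1 : X + 1 ≠ 0 := right_ne_zero_of_mul (hXz ▸ hz0')
  have hinv : algebraMap _ (functionField F (n + 1)) (rhs F n)⁻¹ = X⁻¹ + (X + 1)⁻¹ := by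
    rw [map_inv₀, ← hXz]
    field_simp
    linear_combination (-X) * h2
  rw [hinv] at hp'
  have key : ∀ y : functionField F (n + 1), Q.localRing.valuation y < 1 →
      (y + 1)⁻¹ ∈ Q.localRing := by
    intro y hy
    rw [← ValuationSubring.valuation_le_one_iff, add_comm y 1, map_inv₀,
      Valuation.map_one_add_of_lt _ hy, inv_one]
  by_cases h1 : Q.localRing.valuation X < 1
  · refine .zero hn.add_one h1 ?_
    rw [hn']
    refine hp'.of_sub_mem ?_
    rw [← hX, add_sub_cancel_left]
    exact key X h1
  · have h3 : Q.localRing.valuation (X + 1) < 1 := by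
      by_contra h3
      rw [← hXz, map_mul] at hz1'
      exact absurd hz1' (not_lt.2 (one_le_mul (not_lt.1 h1) (not_lt.1 h3)))
    refine .one hn.add_one h3 ?_
    rw [hn']
    refine hp'.of_sub_mem ?_
    rw [← hX, add_sub_cancel_right]
    have := key _ h3
    have e : X + 1 + 1 = X := by linear_combination h2
    rwa [e] at this

/-- With u = x_n + 1 and X = x_{n+1}, one has X² + X + 1 = u²/(1 + u). Thus X takes a third root of
unity ε as value, and X/(X² + X + 1) = X(u⁻² + u⁻¹). Replacing the factor X by ε costs only a
regular function, because X - ε vanishes like u²; one unit of depth is gained. -/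
theorem pointType_succ_of_one [IsAlgClosed F] {n : ℕ} {P : Point F n} {Q : Point F (n + 1)}
    (h : Q.LiesOver P) (hn : Odd n) (hv : P.localRing.valuation (last F n + 1) < 1)
    (hp : IsTwistedPole F P.localRing (n / 2) (last F n + 1)⁻¹) : PointType Q := by
  have h2 : (2 : functionField F (n + 1)) = 0 := CharTwo.two_eq_zero
  have h2' : (2 : functionField F n) = 0 := CharTwo.two_eq_zero
  have hx : last F n = 1 + (last F n + 1) := by linear_combination -h2'
  have hx1 : P.localRing.valuation (last F n) = 1 := by
    rw [hx]; exact Valuation.map_one_add_of_lt _ hv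
  have hx0 : last F n ≠ 0 := by
    rw [← P.localRing.valuation.ne_zero_iff, hx1]; exact one_ne_zero
  have hxinv : (last F n)⁻¹ ∈ P.localRing := by
    rw [← ValuationSubring.valuation_le_one_iff, map_inv₀, hx1, inv_one]
  have hu0 : last F n + 1 ≠ 0 := by
    intro e
    apply hp.not_mem
    rw [e, inv_zero]; exact zero_mem _
  have hy : rhs F n - (0 ^ 2 + 0) ∈ P.localRing := by
    rw [rhs_eq]
    simpa using add_mem (mem_of_valuation_lt_one hv) hxinv
  obtain ⟨hun, hmem⟩ := Point.unramified_of_sub_mem hy h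
  have hp' := hp.extend h.comap_eq hun
  obtain ⟨t, ht⟩ := hp'.exists_isLocalParam
  rw [map_zero, sub_zero] at hmem
  obtain ⟨ε, hε1⟩ := ht.exists_residue hmem
  have hn' : (n + 1) / 2 = n / 2 + 1 := by
    obtain ⟨m, rfl⟩ := hn; omega
  set X := last F (n + 1) with hX
  set u := algebraMap _ (functionField F (n + 1)) (last F n + 1) with hu
  have hu1 : Q.localRing.valuation u < 1 := (valuation_algebraMap_lt_one_iff h.comap_eq).2 hv
  have hu0' : u ≠ 0 := by rw [hu]; exact (map_ne_zero _).2 hu0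
  have h1u := one_add_ne_zero hu1
  have hxu : algebraMap _ (functionField F (n + 1)) (last F n) = 1 + u := by
    rw [hx, map_add, map_one]
  have hq : X ^ 2 + X + 1 = u ^ 2 * (1 + u)⁻¹ := by
    rw [hX, last_succ, rhs_eq, map_add, map_add, map_one, map_inv₀, hxu]
    field_simp
    linear_combination (2 + 2 * u) * h2
  have hqv : Q.localRing.valuation (X ^ 2 + X + 1) < 1 := by
    rw [hq, map_mul, map_inv₀, Valuation.map_one_add_of_lt _ hu1, inv_one, mul_one, pow_two]
    exact valuation_mul_lt_one (mem_of_valuation_lt_one hu1) hu1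
  -- The residue ε of X is a root because X² + X + 1 vanishes at Q.
  have hε : ε ^ 2 + ε + 1 = 0 := by
    by_contra hne
    have h3 : Q.localRing.valuation (algebraMap F _ (ε ^ 2 + ε + 1)) < 1 := by
      have e : algebraMap F (functionField F (n + 1)) (ε ^ 2 + ε + 1) = (X ^ 2 + X + 1) -
          (X + algebraMap F _ ε + 1) * (X - algebraMap F _ ε) := by
        simp only [map_add, map_pow, map_one]; ring
      rw [e]
      refine Valuation.map_sub_lt _ hqv (valuation_mul_lt_one ?_ hε1)
      exact add_mem (add_mem hmem (Q.algebraMap_mem ε)) (one_mem _)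
    rw [valuation_const Q.algebraMap_mem hne] at h3
    exact lt_irrefl _ h3
  refine .thirdRoot hn.add_one ε hε hε1 ?_
  rw [hn']
  refine ⟨ε, hε, _, hp', ?_⟩
  rw [← hX, map_inv₀, ← hu]
  have hv1 := valuation_thirdRoot_factor Q hε1
  have hfac := thirdRoot_factor hε X
  set e₁ := X - algebraMap F (functionField F (n + 1)) ε + algebraMap F _ (2 * ε + 1) with he₁
  have he0 : e₁ ≠ 0 := by
    rw [← Q.localRing.valuation.ne_zero_iff, hv1]; exact one_ne_zero
  have hgoal : X / (X ^ 2 + X + 1) - algebraMap F _ ε * (u⁻¹ ^ 2 + u⁻¹) = e₁⁻¹ := by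
    have h4 : X - algebraMap F (functionField F (n + 1)) ε = u ^ 2 * (1 + u)⁻¹ * e₁⁻¹ := by
      rw [← hq, hfac]; field_simp
    have h5 : X / (X ^ 2 + X + 1) - algebraMap F _ ε * (u⁻¹ ^ 2 + u⁻¹) =
        (X - algebraMap F _ ε) * ((1 + u) * u⁻¹ ^ 2) := by
      rw [hq]; field_simp
    rw [h5, h4]; field_simp
  rw [hgoal, ← ValuationSubring.valuation_le_one_iff, map_inv₀, hv1, inv_one]

theorem pointType_succ [IsAlgClosed F] {n : ℕ} {P : Point F n} {Q : Point F (n + 1)}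
    (h : Q.LiesOver P) (hP : PointType P) : PointType Q := by
  cases hP with
  | thirdRoot hn ε hε hv hp => exact pointType_succ_of_thirdRoot h hn hε hv hp
  | one hn hv hp => exact pointType_succ_of_one h hn hv hp
  | zero hn hv hp =>
    refine .pole (last_succ_not_mem h fun hz => hp.not_mem ?_)
    have e : (last F n)⁻¹ = rhs F n - (last F n + 1) := by rw [rhs_eq]; ring
    rw [e]
    exact sub_mem hz (add_mem (mem_of_valuation_lt_one hv) (one_mem _))
  | pole hv =>
    refine .pole (last_succ_not_mem h fun hz => hv ?_)
    have e : last F n = rhs F n - (rhs F n - last F n) := by ring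
    rw [e]
    exact sub_mem hz (rhs_sub_last_mem hv)

theorem pointType_of_hasIndexSequence [IsAlgClosed F] {a : ℕ → OnePoint F} {ε : F}
    (hε : ε ^ 2 + ε + 1 = 0) (ha : a 0 = (ε : OnePoint F)) {n : ℕ} (P : Point F n)
    (hP : P.HasIndexSequence a) : PointType P := by
  induction n with
  | zero =>
    have := hP 0 le_rfl
    rw [ha] at this
    exact pointType_zero P hε this
  | succ n ih =>
    obtain ⟨P', h⟩ := P.exists_image
    exact pointType_succ h (ih P' (hP.image h))

theorem odd_and_isTwistedPole_of_zero [IsAlgClosed F] {a : ℕ → OnePoint F} {ε : F}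
    (hε : ε ^ 2 + ε + 1 = 0) (ha : a 0 = (ε : OnePoint F)) {i : ℕ}
    (hai : a i = ((0 : F) : OnePoint F)) (P : Point F i) (hP : P.HasIndexSequence a) :
    Odd i ∧ IsTwistedPole F P.localRing (i / 2) (rhs F i) := by
  have h0 : P.localRing.valuation (last F i) < 1 := by
    have := hP i le_rfl
    rw [hai] at this
    change P.localRing.valuation (coord F i i _ - algebraMap F _ 0) < 1 at this
    rwa [map_zero, sub_zero] at this
  cases pointType_of_hasIndexSequence hε ha P hP with
  | thirdRoot hn ε hε hv hp =>
    rw [valuation_eq_one_of_sub_lt_one P.algebraMap_mem (thirdRoot_ne_zero hε) hv] at h0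
    exact absurd h0 (lt_irrefl _)
  | one hn hv hp =>
    rw [add_comm, Valuation.map_one_add_of_lt _ h0] at hv
    exact absurd hv (lt_irrefl _)
  | zero hn hv hp =>
    refine ⟨hn, hp.of_sub_mem ?_⟩
    have e : (last F i)⁻¹ - rhs F i = -(last F i + 1) := by rw [rhs_eq]; ring
    rw [e]
    exact neg_mem (add_mem (mem_of_valuation_lt_one hv) (one_mem _))
  | pole hv => exact absurd (mem_of_valuation_lt_one h0) hv

/-- The poles of `x_{i+j} + 1 + 1 / x_{i+j}` at the points `P(a₀, …, a_{i-1}, 0, ∞^j)`. -/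
theorem rhs_pole [IsAlgClosed F] {a : ℕ → OnePoint F} {ε : F} (hε : ε ^ 2 + ε + 1 = 0)
    (ha : a 0 = (ε : OnePoint F)) {i : ℕ} (hai : a i = ((0 : F) : OnePoint F)) (j : ℕ)
    (P : Point F (i + j)) (hP : P.HasIndexSequence a) :
    (Even j → IsTwistedPole F P.localRing (i / 2 - j / 2) (rhs F (i + j))) ∧
      (Odd j → IsArtinSchreierPole F P.localRing (i / 2 - j / 2) (rhs F (i + j))) := by
  induction j with
  | zero =>
    exact ⟨fun _ => (odd_and_isTwistedPole_of_zero hε ha hai P hP).2, fun h => absurd h (by simp)⟩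
  | succ j ih =>
    obtain ⟨P', h⟩ := Point.exists_image (n := i + j) P
    obtain ⟨he, ho⟩ := ih P' (hP.image (n := i + j) h)
    rcases Nat.even_or_odd j with hj | hj
    · refine ⟨fun h' => absurd hj.add_one (Nat.not_odd_iff_even.2 h'), fun _ => ?_⟩
      have h1 := (Point.ramified_of_isTwistedPole (he hj)).2 P h
      have hj' : (j + 1) / 2 = j / 2 := by obtain ⟨m, rfl⟩ := hj; omega
      rw [hj']
      refine h1.of_sub_mem ?_
      rw [← neg_mem_iff, neg_sub]
      exact rhs_sub_last_mem (n := i + j + 1) h1.not_mem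
    · refine ⟨fun _ => ?_, fun h' => absurd hj.add_one (Nat.not_even_iff_odd.2 h')⟩
      have h1 : IsTwistedPole F P.localRing (i / 2 - (j + 1) / 2) (last F (i + j + 1)) := by
        have hj' : (j + 1) / 2 = j / 2 + 1 := by obtain ⟨m, rfl⟩ := hj; omega
        rw [hj']
        have h2 := ho hj
        -- The subtraction is truncated: at depth 0 an Artin-Schreier pole is a simple pole, the
        -- step is ramified, and the depth stays 0. Otherwise the step is unramified and the depth
        -- falls by one.
        rcases hk : i / 2 - j / 2 with _ | k
        · have hk' : i / 2 - (j / 2 + 1) = 0 := by omega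
          rw [hk] at h2
          rw [hk']
          exact (Point.ramified_of_isTwistedPole (r := 0) h2).2 P h
        · have hk' : i / 2 - (j / 2 + 1) = k := by omega
          rw [hk] at h2
          rw [hk']
          exact (Point.unramified_of_isArtinSchreierPole h2).2 P h
      refine h1.of_sub_mem ?_
      rw [← neg_mem_iff, neg_sub]
      exact rhs_sub_last_mem (n := i + j + 1) h1.not_mem

end ASTower

theorem mainTheorem6 {F : Type*} [Field F] [Algebra (ZMod 2) F] [IsAlgClosure (ZMod 2) F]
    (ρ : F) (hρ : IsPrimitiveRoot ρ 3) (i j : ℕ) (a : ℕ → OnePoint F)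
    (ha₀ : a 0 = (ρ : OnePoint F) ∨ a 0 = ((ρ ^ 2 : F) : OnePoint F))
    (hai : a i = ((0 : F) : OnePoint F))
    (ha : ∀ k, i < k → k ≤ i + j → a k = OnePoint.infty)
    (P : ASTower.Point F (i + j)) (hP : P.HasIndexSequence a) :
    ((Even j ∧ j + 3 ≤ i) ∨ i ≤ j + 1 → P.IsTotallyRamified ∧ P.Contributes 2) ∧
    (Odd j ∧ j + 2 ≤ i → P.IsUnramified) := by
  have : CharP F 2 := charP_of_injective_algebraMap (algebraMap (ZMod 2) F).injective 2
  have : IsAlgClosed F := IsAlgClosure.isAlgClosed (ZMod 2)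
  have h2 : (2 : F) = 0 := CharTwo.two_eq_zero
  have hρ1 : ρ ^ 2 + ρ + 1 = 0 := by
    have h1 : ρ - 1 ≠ 0 := sub_ne_zero.2 (hρ.ne_one (by norm_num))
    apply mul_left_cancel₀ h1
    linear_combination hρ.pow_eq_one
  obtain ⟨ε, hε, hε0⟩ : ∃ ε : F, ε ^ 2 + ε + 1 = 0 ∧ a 0 = (ε : OnePoint F) := by
    rcases ha₀ with h | h
    · exact ⟨ρ, hρ1, h⟩
    · refine ⟨ρ ^ 2, ?_, h⟩
      linear_combination (ρ ^ 2 - ρ + 1) * hρ1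
  have hi : Odd i := by
    clear ha
    induction j with
    | zero => exact (ASTower.odd_and_isTwistedPole_of_zero hε hε0 hai P hP).1
    | succ j ih =>
      obtain ⟨P', h⟩ := ASTower.Point.exists_image (n := i + j) P
      exact ih P' (hP.image (n := i + j) h)
  obtain ⟨he, ho⟩ := ASTower.rhs_pole hε hε0 hai j P hP
  obtain ⟨m, rfl⟩ := hi
  constructor
  · intro hj
    rcases Nat.even_or_odd j with hj' | hj'
    · exact (ASTower.Point.ramified_of_isTwistedPole (he hj')).1
    · have h1 := ho hj'
      -- For odd j only i ≤ j + 1 can hold. As i is odd too, this means i ≤ j, so the depth is used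
      -- up.
      have hk : (2 * m + 1) / 2 - j / 2 = 0 := by
        obtain ⟨l, rfl⟩ := hj'
        rcases hj with ⟨⟨l', hl'⟩, -⟩ | hj <;> omega
      rw [hk] at h1
      exact (ASTower.Point.ramified_of_isTwistedPole (r := 0) h1).1
  · rintro ⟨hj, hle⟩
    have h1 := ho hj
    -- For j = 2l + 1 the depth is m - l, which is positive exactly when j ≤ i - 2.
    obtain ⟨k, hk⟩ : ∃ k, (2 * m + 1) / 2 - j / 2 = k + 1 := by
      obtain ⟨l, rfl⟩ := hj
      exact ⟨m - l - 1, by omega⟩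
    rw [hk] at h1
    exact (ASTower.Point.unramified_of_isArtinSchreierPole h1).1
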